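/- Let $H$ be a complex Hilbert space, let $\mathcal N\subseteq B(H)$ be a von Neumann algebra with a faithful normal semi-finite trace $\tau$, and fix $0<q<\infty$. For $A\in\mathcal N$ put $\mu(t,A)=\inf\{\|Ap\|:\ p\in\mathcal N \text{ a projection},\ \tau(1-p)\le t\}$ and $$\mathcal M_{1,\infty}=\Big\{A\in\mathcal N:\ \sup_{t>0}\frac1{\log(1+t)}\int_0^t\mu(s,A)\,ds<\infty\Big\}.$$ Let $L_\infty(0,\infty)$ be the space of bounded Lebesgue measurable real functions on $(0,\infty)$. A *generalised limit* is a positive linear functional $\gamma:L_\infty(0,\infty)\to\mathbb R$ with $\gamma(1)=1$ and $\gamma(z)=0$ whenever $\lim_{t\to\infty}z(t)=0$; it is *dilation invariant* if $\gamma(\sigma_sz)=\gamma(z)$ for all $s>0$ and all $z$, where $(\sigma_sz)(t)=z(t/s)$. Put $(Mx)(t)=\frac1{\log t}\int_1^tx(s)\frac{ds}{s}$, and for $0\le A\in\mathcal M_{1,\infty}$ and a generalised limit $\gamma$ put $$\xi_\gamma(A)=(\gamma\circ M)\Big(t\mapsto\tfrac1t\,\tau\big(\exp(-(tA)^{-q})\big)\Big),$$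 where $\exp(-(tA)^{-q})$ is $f(tA)$ for the function $f(x)=\exp(-x^{-q})$ $(x>0)$, $f(0)=0$. For arbitrary $A\in\mathcal M_{1,\infty}$ put $$\xi_\gamma(A)=\xi_\gamma(\Re(A)_+)-\xi_\gamma(\Re(A)_-)+i\big(\xi_\gamma(\Im(A)_+)-\xi_\gamma(\Im(A)_-)\big).$$ Then $\xi_\gamma$ is well defined: for $0\le A\in\mathcal M_{1,\infty}$ one has $\tau(\exp(-(tA)^{-q}))<\infty$ for all $t>0$, and $M\big(t\mapsto\frac1t\tau(\exp(-(tA)^{-q}))\big)\in L_\infty(0,\infty)$ (any value is allowed at the single point $t=1$). If $\gamma$ is a generalised limit for which $\xi_\gamma$ is a linear functional on $\mathcal M_{1,\infty}$, then there exists a dilation invariant generalised limit $\omega$ with $\xi_\gamma(A)=\xi_\omega(A)$ for all $A\in\mathcal M_{1,\infty}$; moreover $\omega$ can be chosen to take equal values on almost everywhere equal functions, so that the assertion holds whether the elements of $L_\infty(0,\infty)$ are regarded as functions or as almost everywhere equivalence classes. -/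

import Mathlib

open MeasureTheory Filter Topology Set
open scoped ENNReal NNReal ComplexStarModule

noncomputable section

namespace HeatKernel

/-! ### Bounded measurable functions on the semi-axis and generalised limits -/

/-- The semi-axis `(0, ∞)`. -/
abbrev SemiAxis : Type := {t : ℝ // 0 < t}

/-- Lebesgue measure on the semi-axis. -/
def lebesgue : Measure SemiAxis := Measure.comap Subtype.val (volume : Measure ℝ)

/-- `L_∞(0, ∞)`: the bounded Lebesgue measurable real functions on `(0, ∞)`.
(Almost everywhere measurable with respect to the Borel sigma-algebra is the same as
measurable with respect to the Lebesgue sigma-algebra.) -/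
def LInfty : Submodule ℝ (SemiAxis → ℝ) where
  carrier := {x | AEMeasurable x lebesgue ∧ ∃ C : ℝ, ∀ t, |x t| ≤ C}
  zero_mem' := ⟨aemeasurable_const, 0, fun t => by simp⟩
  add_mem' := by
    rintro x y ⟨hx, C, hC⟩ ⟨hy, D, hD⟩
    exact ⟨hx.add hy, C + D, fun t => (abs_add_le _ _).trans (add_le_add (hC t) (hD t))⟩
  smul_mem' := by
    rintro c x ⟨hx, C, hC⟩
    refine ⟨hx.const_smul c, |c| * C, fun t => ?_⟩
    change |c • x t| ≤ _
    rw [smul_eq_mul, abs_mul]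
    exact mul_le_mul_of_nonneg_left (hC t) (abs_nonneg c)

/-- The map `t ↦ t / s` of the semi-axis, for `s > 0`. -/
def scale (s : ℝ) (hs : 0 < s) (t : SemiAxis) : SemiAxis := ⟨t.1 / s, div_pos t.2 hs⟩

theorem quasiMeasurePreserving_scale (s : ℝ) (hs : 0 < s) :
    Measure.QuasiMeasurePreserving (scale s hs) lebesgue lebesgue := by
  have hm : Measurable (scale s hs) := (measurable_subtype_coe.div_const s).subtype_mk
  refine ⟨hm, Measure.AbsolutelyContinuous.mk fun A hA h0 => ?_⟩
  have hio : MeasurableSet {t : ℝ | 0 < t} := measurableSet_Ioi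
  rw [Measure.map_apply hm hA]
  have key : ∀ B : Set SemiAxis, lebesgue B = volume (Subtype.val '' B) :=
    fun B => comap_subtype_coe_apply hio volume B
  rw [key] at h0 ⊢
  have hsub : (Subtype.val '' (scale s hs ⁻¹' A)) ⊆
      (fun t : ℝ => s⁻¹ * t) ⁻¹' (Subtype.val '' A) := by
    rintro _ ⟨t, ht, rfl⟩
    exact ⟨scale s hs t, ht, by simp only [scale]; ring⟩
  refine measure_mono_null hsub ?_
  rw [Real.volume_preimage_mul_left (inv_ne_zero hs.ne'), h0, mul_zero]

/-- The dilation operator `(σ_s x)(t) = x(t / s)` on `L_∞(0, ∞)`. -/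
def dilation (s : ℝ) (hs : 0 < s) : LInfty →ₗ[ℝ] LInfty where
  toFun x := ⟨fun t => x.1 (scale s hs t),
    And.intro (x.2.1.comp_quasiMeasurePreserving (quasiMeasurePreserving_scale s hs))
      (x.2.2.imp fun _ h _ => h _)⟩
  map_add' _ _ := rfl
  map_smul' _ _ := rfl

/-- A generalised limit: a positive normalised linear functional on `L_∞(0, ∞)` that vanishes on
every function tending to `0` at infinity. -/
structure IsGeneralisedLimit (γ : LInfty →ₗ[ℝ] ℝ) : Prop where
  nonneg : ∀ z : LInfty, (∀ t, 0 ≤ z.1 t) → 0 ≤ γ z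
  normalised : ∀ z : LInfty, (∀ t, z.1 t = 1) → γ z = 1
  vanish : ∀ z : LInfty, Tendsto z.1 atTop (𝓝 0) → γ z = 0

/-- Dilation invariance of a linear functional on `L_∞(0, ∞)`. -/
def IsDilationInvariant (γ : LInfty →ₗ[ℝ] ℝ) : Prop :=
  ∀ (s : ℝ) (hs : 0 < s) (z : LInfty), γ (dilation s hs z) = γ z

/-- The functional takes equal values on almost everywhere equal functions, i.e. it is a functional
on almost everywhere equivalence classes. -/
def RespectsAE (γ : LInfty →ₗ[ℝ] ℝ) : Prop :=
  ∀ z w : LInfty, z.1 =ᵐ[lebesgue] w.1 → γ z = γ w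

/-- The (logarithmic) Cesàro operator `(Mx)(t) = (1 / log t) ∫_1^t x(s) ds/s` for `t > 0`. -/
def cesaro (x : ℝ → ℝ) (t : SemiAxis) : ℝ :=
  (1 / Real.log t.1) * ∫ s in (1 : ℝ)..t.1, x s / s

open Classical in
/-- The value of a functional on a function on `(0, ∞)`, when this function is in `L_∞(0, ∞)`
(and `0` otherwise). -/
def evalAt (γ : LInfty →ₗ[ℝ] ℝ) (x : SemiAxis → ℝ) : ℝ :=
  if hx : x ∈ LInfty then γ ⟨x, hx⟩ else 0

/-! ### Traces on von Neumann algebras and the Dixmier ideal -/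

universe u

variable {H : Type u} [NormedAddCommGroup H] [InnerProductSpace ℂ H] [CompleteSpace H]

/-- `τ` is a faithful normal semi-finite trace on the von Neumann algebra `N`. Only the values of
`τ` on the positive elements of `N` matter. -/
structure IsFaithfulNormalSemifiniteTrace (N : VonNeumannAlgebra H)
    (τ : (H →L[ℂ] H) → ℝ≥0∞) : Prop where
  map_add : ∀ a ∈ N, ∀ b ∈ N, 0 ≤ a → 0 ≤ b → τ (a + b) = τ a + τ b
  map_smul : ∀ c : ℝ≥0, ∀ a ∈ N, 0 ≤ a → τ ((c : ℝ) • a) = c * τ a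
  tracial : ∀ a ∈ N, τ (star a * a) = τ (a * star a)
  faithful : ∀ a ∈ N, 0 ≤ a → τ a = 0 → a = 0
  normal : ∀ S : Set (H →L[ℂ] H), S.Nonempty → (∀ a ∈ S, a ∈ N ∧ 0 ≤ a) →
    DirectedOn (· ≤ ·) S → ∀ b ∈ N, IsLUB S b → τ b = ⨆ a ∈ S, τ a
  semifinite : ∀ a ∈ N, 0 ≤ a → a ≠ 0 → ∃ b ∈ N, 0 ≤ b ∧ b ≤ a ∧ b ≠ 0 ∧ τ b < ∞

/-- The generalised singular value function
`μ(t, A) = inf {‖A p‖ : p a projection in N with τ(1 - p) ≤ t}`. -/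
def singularValue (N : VonNeumannAlgebra H) (τ : (H →L[ℂ] H) → ℝ≥0∞) (A : H →L[ℂ] H)
    (t : ℝ) : ℝ :=
  sInf {r : ℝ | ∃ p ∈ N, IsStarProjection p ∧ τ (1 - p) ≤ ENNReal.ofReal t ∧ r = ‖A * p‖}

/-- The Marcinkiewicz operator space (Dixmier ideal) `𝓜_{1,∞}(N, τ)`: all `A ∈ N` with
`sup_{t > 0} (1 / log (1 + t)) ∫_0^t μ(s, A) ds < ∞`. -/
def dixmierIdeal (N : VonNeumannAlgebra H) (τ : (H →L[ℂ] H) → ℝ≥0∞) : Set (H →L[ℂ] H) :=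
  {A | A ∈ N ∧ ∃ C : ℝ, ∀ t : ℝ, 0 < t →
    (1 / Real.log (1 + t)) * ∫ s in (0 : ℝ)..t, singularValue N τ A s ≤ C}

/-! ### The functionals `ξ_γ` -/

/-- The function `x ↦ exp (-x ^ (-q))` on `[0, ∞)`, equal to its limit `0` at `x = 0`
(and extended by `0` to the negative reals, which do not matter). -/
def expNegPow (q x : ℝ) : ℝ := if 0 < x then Real.exp (-(x ^ (-q))) else 0

/-- The operator `exp (-(tA) ^ (-q))`, through the continuous functional calculus of `tA`. -/
def heatOp (q : ℝ) (A : H →L[ℂ] H) (t : ℝ) : H →L[ℂ] H := cfc (expNegPow q) (t • A)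

/-- The heat kernel function `t ↦ (1 / t) τ(exp (-(tA) ^ (-q)))`. -/
def heatFun (τ : (H →L[ℂ] H) → ℝ≥0∞) (q : ℝ) (A : H →L[ℂ] H) (t : ℝ) : ℝ :=
  (1 / t) * (τ (heatOp q A t)).toReal

/-- `ξ_γ(A) = (γ ∘ M)(t ↦ (1 / t) τ(exp (-(tA) ^ (-q))))` for positive `A`. -/
def xiPos (τ : (H →L[ℂ] H) → ℝ≥0∞) (q : ℝ) (γ : LInfty →ₗ[ℝ] ℝ) (A : H →L[ℂ] H) : ℝ :=
  evalAt γ (cesaro (heatFun τ q A))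

/-- `ξ_γ(A)` for arbitrary `A`, through the positive and negative parts of the real and the
imaginary part of `A`. -/
def xi (τ : (H →L[ℂ] H) → ℝ≥0∞) (q : ℝ) (γ : LInfty →ₗ[ℝ] ℝ) (A : H →L[ℂ] H) : ℂ :=
  ((xiPos τ q γ (ℜ A : H →L[ℂ] H)⁺ - xiPos τ q γ (ℜ A : H →L[ℂ] H)⁻ : ℝ) : ℂ) +
    Complex.I * ((xiPos τ q γ (ℑ A : H →L[ℂ] H)⁺ - xiPos τ q γ (ℑ A : H →L[ℂ] H)⁻ : ℝ) : ℂ)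

/-- `φ` restricts to a complex linear functional on the set `S` (in the application, a linear
subspace) of operators. -/
structure IsLinearFunctionalOn (S : Set (H →L[ℂ] H)) (φ : (H →L[ℂ] H) → ℂ) : Prop where
  map_add : ∀ A ∈ S, ∀ B ∈ S, φ (A + B) = φ A + φ B
  map_smul : ∀ (c : ℂ), ∀ A ∈ S, φ (c • A) = c * φ A

end HeatKernel

end

/-!
For a projection `p` with `‖A p‖` small, `ℜ A` is at most a small multiple of `1` plus a multiple of
`1 - p`. Hence `τ(F(ℜ A)) = O(τ(1 - p))` for every bounded `F ≥ 0` vanishing near and below `0`, and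
cutting an increasing `F` into dyadic layers gives `τ(F(ℜ A)) ≤ 2 ∫_0^∞ F(8 μ(s, A)) ds`. With
`F(x) = exp(-(tx)^(-q))` and the growth of `∫_0^t μ` this bounds the logarithmic mean `M h` of
`h(t) = t⁻¹ τ(exp(-(t (ℜ A)_+)^(-q)))`.

Since `log t · (M h)(t)` is increasing, `M h` hardly decreases while `log t` grows by one. For such
a function the mean over a window of `n` units of `log t` differs, under `γ`, from the average of
its `n` unit shifts by a telescoping sum, that is by `O(1 / n)`. If moreover `γ` does not see the
shifts, then `γ` of the window mean converges to `γ`; and homogeneity of `ξ_γ` says exactly that `γ`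
is invariant under the dilations of the function defining `Re ξ_γ(A)`. So `ω` can be taken to be an
ultrafilter limit of `γ` composed with the window means, which is dilation invariant on all of
`L_∞(0, ∞)` and, being built from integrals, only sees almost everywhere equivalence classes.
-/

noncomputable section

namespace HeatKernel

/-! ### Inequalities in C⋆-algebras -/

section CStarAlgebra

variable {E : Type*} [CStarAlgebra E]

theorem cfc_mul_self_mul_cfc {f : ℝ → ℝ} (hf : Continuous f) {a : E} (ha : IsSelfAdjoint a) :
    cfc f a * a * cfc f a = cfc (fun x => f x ^ 2 * x) a := by
  conv_lhs => enter [1, 2]; rw [← cfc_id' ℝ a]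
  rw [← cfc_mul _ _ a hf.continuousOn, ← cfc_mul _ _ a (hf.fun_mul continuous_id').continuousOn
    hf.continuousOn]
  congr 1
  ext x
  ring

theorem cfc_posPart {f : ℝ → ℝ} (hf : Continuous f) {a : E} (ha : IsSelfAdjoint a) :
    cfc f a⁺ = cfc (fun x => f x⁺) a := by
  rw [CFC.posPart_def, cfcₙ_eq_cfc, cfc_comp' f (·⁺) a hf.continuousOn]

variable [PartialOrder E] [StarOrderedRing E]

theorem realPart_le_algebraMap_add_star_mul_self (a : E) {c : ℝ} (hc : 0 < c) :
    (ℜ a : E) ≤ algebraMap ℝ E c + (4 * c)⁻¹ • (star a * a) := by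
  have h := smul_nonneg (inv_nonneg.2 (by positivity : 0 ≤ 4 * c))
    (star_mul_self_nonneg (a - algebraMap ℝ E (2 * c)))
  have expand : (4 * c)⁻¹ • (star (a - algebraMap ℝ E (2 * c)) * (a - algebraMap ℝ E (2 * c))) =
      algebraMap ℝ E c + (4 * c)⁻¹ • (star a * a) - (ℜ a : E) := by
    rw [realPart_apply_coe]
    simp only [Algebra.algebraMap_eq_smul_one, star_sub, star_smul, star_one, star_trivial,
      sub_mul, mul_sub, smul_mul_assoc, mul_smul_comm, one_mul, mul_one]
    match_scalars <;> field_simp <;> norm_num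
  exact sub_nonneg.1 (expand ▸ h)

theorem realPart_le_of_norm_mul_le {a p : E} (hp : IsStarProjection p) {r : ℝ} (hr : 0 < r)
    (h : ‖a * p‖ ≤ r) :
    (ℜ a : E) ≤ algebraMap ℝ E (2 * r) + ((4 * r)⁻¹ * ‖a‖ ^ 2) • (1 - p) := by
  have on_p : (ℜ (a * p) : E) ≤ algebraMap ℝ E r :=
    (IsSelfAdjoint.le_algebraMap_norm_self (ℜ (a * p)).2).trans
      (algebraMap_mono E ((realPart.norm_le _).trans h))
  have hq : IsStarProjection (1 - p) := hp.one_sub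
  have compress : star (a * (1 - p)) * (a * (1 - p)) ≤ ‖a‖ ^ 2 • (1 - p) := by
    have := hq.isSelfAdjoint.conjugate_le_conjugate
      (CStarAlgebra.star_mul_le_algebraMap_norm_sq (a := a))
    rwa [Algebra.algebraMap_eq_smul_one, mul_smul_comm, smul_mul_assoc, mul_one,
      hq.isIdempotentElem.eq, ← mul_assoc, mul_assoc _ a, ← hq.isSelfAdjoint.star_eq, ← star_mul,
      hq.isSelfAdjoint.star_eq] at this
  have off_p := realPart_le_algebraMap_add_star_mul_self (a * (1 - p)) hr
  calc (ℜ a : E) = (ℜ (a * p) : E) + (ℜ (a * (1 - p)) : E) := by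
        rw [← AddMemClass.coe_add, ← map_add, ← mul_add, add_sub_cancel, mul_one]
    _ ≤ algebraMap ℝ E r + (algebraMap ℝ E r + (4 * r)⁻¹ • (‖a‖ ^ 2 • (1 - p))) := by
        gcongr
        exact off_p.trans (by gcongr)
    _ = algebraMap ℝ E (2 * r) + ((4 * r)⁻¹ * ‖a‖ ^ 2) • (1 - p) := by
        rw [two_mul, map_add, add_assoc, smul_smul]

theorem cfc_one_sub_inv_one_add_mono {a b : E} (ha : 0 ≤ a) (hab : a ≤ b) :
    cfc (fun x : ℝ => 1 - (1 + x)⁻¹) a ≤ cfc (fun x : ℝ => 1 - (1 + x)⁻¹) b := by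
  have cfcₙ_eq : ∀ {c : E}, 0 ≤ c →
      cfcₙ (fun x : ℝ => 1 - (1 + x)⁻¹) c = cfc (fun x : ℝ => 1 - (1 + x)⁻¹) c := fun hc =>
    cfcₙ_eq_cfc (hf := continuousOn_const.sub ((continuousOn_const.add continuousOn_id).inv₀
      fun x hx => (add_pos_of_pos_of_nonneg one_pos
        (quasispectrum_nonneg_of_nonneg _ hc x hx)).ne'))
      (hf0 := by norm_num)
  rw [← cfcₙ_eq ha, ← cfcₙ_eq (ha.trans hab)]
  exact CFC.monotoneOn_one_sub_one_add_inv_real ha (ha.trans hab) hab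

end CStarAlgebra

/-! ### Traces of spectral functions -/

variable {H : Type*} [NormedAddCommGroup H] [InnerProductSpace ℂ H] [CompleteSpace H]
  {N : VonNeumannAlgebra H} {τ : (H →L[ℂ] H) → ℝ≥0∞}

section VonNeumannAlgebra

variable {A : H →L[ℂ] H}

theorem cfc_mem (hA : A ∈ N) (f : ℝ → ℝ) : cfc f A ∈ N := by
  rw [← VonNeumannAlgebra.commutant_commutant N, VonNeumannAlgebra.mem_commutant_iff]
  intro B hB
  have hAB : Commute A B := VonNeumannAlgebra.mem_commutant_iff.1 hB A hA
  exact (hAB.cfc_real f).symm.eq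

theorem smul_mem (hA : A ∈ N) (c : ℂ) : c • A ∈ N :=
  N.toStarSubalgebra.smul_mem hA c

theorem real_smul_mem (hA : A ∈ N) (c : ℝ) : c • A ∈ N := by
  rw [← Complex.coe_smul]
  exact smul_mem hA c

theorem realPart_mem (hA : A ∈ N) : (ℜ A : H →L[ℂ] H) ∈ N := by
  rw [realPart_apply_coe]
  exact real_smul_mem (add_mem hA (star_mem hA)) _

end VonNeumannAlgebra

/-- A normal, not necessarily faithful or semi-finite, trace on the von Neumann algebra `N`. As in
`IsFaithfulNormalSemifiniteTrace`, only the values of `τ` on the positive elements of `N` matter. -/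
structure IsNormalTrace (N : VonNeumannAlgebra H) (τ : (H →L[ℂ] H) → ℝ≥0∞) : Prop where
  map_add : ∀ a ∈ N, ∀ b ∈ N, 0 ≤ a → 0 ≤ b → τ (a + b) = τ a + τ b
  map_smul : ∀ c : ℝ≥0, ∀ a ∈ N, 0 ≤ a → τ ((c : ℝ) • a) = c * τ a
  tracial : ∀ a ∈ N, τ (star a * a) = τ (a * star a)
  normal : ∀ S : Set (H →L[ℂ] H), S.Nonempty → (∀ a ∈ S, a ∈ N ∧ 0 ≤ a) →
    DirectedOn (· ≤ ·) S → ∀ b ∈ N, IsLUB S b → τ b = ⨆ a ∈ S, τ a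

theorem IsFaithfulNormalSemifiniteTrace.isNormalTrace (hτ : IsFaithfulNormalSemifiniteTrace N τ) :
    IsNormalTrace N τ :=
  ⟨hτ.map_add, hτ.map_smul, hτ.tracial, hτ.normal⟩

namespace IsNormalTrace

theorem map_zero (hτ : IsNormalTrace N τ) : τ 0 = 0 := by
  simpa using hτ.map_smul 0 0 (zero_mem N) le_rfl

theorem mono (hτ : IsNormalTrace N τ) {a b : H →L[ℂ] H} (ha : a ∈ N) (hb : b ∈ N) (h0 : 0 ≤ a)
    (hab : a ≤ b) : τ a ≤ τ b := by
  have h := hτ.map_add a ha (b - a) (sub_mem hb ha) h0 (sub_nonneg.2 hab)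
  rw [add_sub_cancel] at h
  exact h ▸ le_self_add

theorem map_sum (hτ : IsNormalTrace N τ) {ι : Type*} (s : Finset ι) {a : ι → H →L[ℂ] H}
    (ha : ∀ i, a i ∈ N) (h0 : ∀ i, 0 ≤ a i) : τ (∑ i ∈ s, a i) = ∑ i ∈ s, τ (a i) := by
  classical
  induction s using Finset.induction_on with
  | empty => simpa using hτ.map_zero
  | insert i s hi ih =>
    rw [Finset.sum_insert hi, Finset.sum_insert hi, hτ.map_add _ (ha i) _
      (sum_mem fun j _ => ha j) (h0 i) (Finset.sum_nonneg fun j _ => h0 j), ih]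

theorem eq_iSup_of_tendsto (hτ : IsNormalTrace N τ) {a : ℕ → H →L[ℂ] H} {b : H →L[ℂ] H}
    (ha : ∀ n, a n ∈ N) (h0 : ∀ n, 0 ≤ a n) (hmono : Monotone a) (hb : b ∈ N)
    (hlim : Tendsto a atTop (𝓝 b)) : τ b = ⨆ n, τ (a n) := by
  have h := hτ.normal (range a) (range_nonempty a) (forall_mem_range.2 fun n => ⟨ha n, h0 n⟩)
    (directedOn_range.2 hmono.directed_le) b hb (isLUB_of_tendsto_atTop hmono hlim)
  rwa [iSup_range] at h

theorem mul_star_le_of_mul_eq (hτ : IsNormalTrace N τ) {d p : H →L[ℂ] H} (hd : d ∈ N) (hp : p ∈ N)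
    (hpp : IsStarProjection p) (hdp : d * p = d) (hnorm : ‖d‖ ≤ 1) : τ (d * star d) ≤ τ p := by
  rw [← hτ.tracial d hd]
  refine hτ.mono (mul_mem (star_mem hd) hd) hp (star_mul_self_nonneg d) ?_
  have contraction : star d * d ≤ 1 := by
    refine CStarAlgebra.star_mul_le_algebraMap_norm_sq.trans ?_
    rw [← map_one (algebraMap ℝ (H →L[ℂ] H))]
    exact algebraMap_mono _ (pow_le_one₀ (norm_nonneg d) hnorm)
  calc star d * d = p * (star d * d) * p := by
        conv_lhs => rw [← hdp, star_mul, hpp.isSelfAdjoint.star_eq]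
        simp only [mul_assoc]
    _ ≤ p * 1 * p := hpp.isSelfAdjoint.conjugate_le_conjugate contraction
    _ = p := by rw [mul_one, hpp.isIdempotentElem.eq]

theorem cfc_conj_projection_le (hτ : IsNormalTrace N τ) {X p : H →L[ℂ] H} (hX : X ∈ N)
    (hp : p ∈ N) (hpp : IsStarProjection p) :
    τ (cfc (fun x : ℝ => 1 - (1 + x)⁻¹) (X * p * star X)) ≤ τ p := by
  set T := X * p * star X with hT
  have hTN : T ∈ N := mul_mem (mul_mem hX hp) (star_mem hX)
  have hT0 : 0 ≤ T := star_right_conjugate_nonneg hpp.nonneg X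
  have hcont : Continuous fun x : ℝ => (√(1 + |x|))⁻¹ :=
    (by fun_prop : Continuous fun x : ℝ => √(1 + |x|)).inv₀ fun x => by positivity
  set C := cfc (fun x : ℝ => (√(1 + |x|))⁻¹) T
  -- With `d = (1 + T)^(-1/2) X p` the operator on the left is `d d*`, and its trace is that of
  -- `d* d`.
  set d := C * X * p with hd
  have d_mul_star : d * star d = cfc (fun x : ℝ => 1 - (1 + x)⁻¹) T := by
    have hC : star C = C := IsSelfAdjoint.cfc.star_eq
    calc d * star d = C * T * C := by
          rw [hd, hT, star_mul, star_mul, hC, hpp.isSelfAdjoint.star_eq]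
          simp only [mul_assoc]
          rw [← mul_assoc p p, hpp.isIdempotentElem.eq]
      _ = cfc (fun x : ℝ => (√(1 + |x|))⁻¹ ^ 2 * x) T :=
          cfc_mul_self_mul_cfc hcont hT0.isSelfAdjoint
      _ = cfc (fun x : ℝ => 1 - (1 + x)⁻¹) T := cfc_congr fun x hx => by
          have hx0 : 0 ≤ x := spectrum_nonneg_of_nonneg hT0 hx
          simp only [abs_of_nonneg hx0, inv_pow, Real.sq_sqrt (by positivity : 0 ≤ 1 + x)]
          field_simp
          ring
  have hnorm : ‖d‖ ≤ 1 := by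
    rw [← abs_norm, ← abs_one, ← sq_le_sq, one_pow, sq, ← CStarRing.norm_self_mul_star, d_mul_star]
    refine norm_cfc_le zero_le_one fun x hx => ?_
    have hx0 : 0 ≤ x := spectrum_nonneg_of_nonneg hT0 hx
    have hinv : (1 + x)⁻¹ ≤ 1 := inv_le_one_of_one_le₀ (by linarith)
    rw [Real.norm_of_nonneg (sub_nonneg.2 hinv)]
    exact sub_le_self _ (by positivity)
  rw [← d_mul_star]
  exact hτ.mul_star_le_of_mul_eq (mul_mem (mul_mem (cfc_mem hTN _) hX) hp) hp hpp
    (by rw [hd, mul_assoc, hpp.isIdempotentElem.eq]) hnorm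

theorem cfc_one_sub_inv_le_of_le (hτ : IsNormalTrace N τ) {R p : H →L[ℂ] H} (hR : R ∈ N)
    (hRs : IsSelfAdjoint R) (hp : p ∈ N) (hpp : IsStarProjection p) {b M : ℝ} (hM : 0 ≤ M)
    (hle : R ≤ algebraMap ℝ (H →L[ℂ] H) b + M • p) {k : ℝ → ℝ} (hk : Continuous k)
    (hk0 : ∀ x, 0 ≤ k x ^ 2 * (x - b)) :
    τ (cfc (fun x => 1 - (1 + k x ^ 2 * (x - b))⁻¹) R) ≤ τ p := by
  set h : ℝ → ℝ := fun x => k x ^ 2 * (x - b)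
  have hh : Continuous h := by fun_prop
  have hK : IsSelfAdjoint (cfc k R) := IsSelfAdjoint.cfc
  set X := √M • cfc k R with hX
  have hXN : X ∈ N := real_smul_mem (cfc_mem hR k) _
  have hh0 : 0 ≤ cfc h R := cfc_nonneg fun x _ => hk0 x
  have compress : cfc h R ≤ X * p * star X := by
    have shift : cfc h R = cfc k R * (R - algebraMap ℝ _ b) * cfc k R := by
      rw [mul_sub, sub_mul, cfc_mul_self_mul_cfc hk hRs, Algebra.algebraMap_eq_smul_one,
        mul_smul_comm, mul_one, smul_mul_assoc, ← cfc_mul k k R, ← cfc_const_mul b _ R,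
        ← cfc_sub _ _ R]
      exact cfc_congr fun x _ => by ring
    calc cfc h R ≤ cfc k R * (M • p) * cfc k R :=
          shift ▸ hK.conjugate_le_conjugate (sub_le_iff_le_add'.2 hle)
      _ = X * p * star X := by
          rw [hX, star_smul, hK.star_eq, star_trivial, smul_mul_assoc, mul_smul_comm, mul_smul_comm,
            smul_mul_assoc, smul_mul_assoc, smul_smul, Real.mul_self_sqrt hM]
  have comp : cfc (fun x => 1 - (1 + h x)⁻¹) R = cfc (fun x : ℝ => 1 - (1 + x)⁻¹) (cfc h R) := by
    refine cfc_comp' (fun x : ℝ => 1 - (1 + x)⁻¹) h R (continuousOn_const.sub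
      ((continuousOn_const.add continuousOn_id).inv₀ ?_))
    rintro _ ⟨x, -, rfl⟩
    exact (add_pos_of_pos_of_nonneg one_pos (hk0 x)).ne'
  calc τ (cfc (fun x => 1 - (1 + h x)⁻¹) R)
      ≤ τ (cfc (fun x : ℝ => 1 - (1 + x)⁻¹) (X * p * star X)) := by
        refine hτ.mono (cfc_mem hR _)
          (cfc_mem (mul_mem (mul_mem hXN hp) (star_mem hXN)) _) ?_ ?_
        · exact cfc_nonneg fun x _ => sub_nonneg.2
            (inv_le_one_of_one_le₀ (le_add_of_nonneg_right (hk0 x)))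
        · exact comp ▸ cfc_one_sub_inv_one_add_mono hh0 compress
    _ ≤ τ p := hτ.cfc_conj_projection_le hXN hp hpp

theorem cfc_le_nnreal_mul_cfc (hτ : IsNormalTrace N τ) {R : H →L[ℂ] H} (hR : R ∈ N)
    {f g : ℝ → ℝ} (hf : Continuous f) (hg : Continuous g) (hf0 : ∀ x, 0 ≤ f x)
    (hg0 : ∀ x, 0 ≤ g x) {c : ℝ≥0} (hgf : ∀ x, g x ≤ c * f x) :
    τ (cfc g R) ≤ c * τ (cfc f R) := by
  rw [← hτ.map_smul c _ (cfc_mem hR f) (cfc_nonneg fun x _ => hf0 x),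
    ← cfc_const_mul (c : ℝ) f R hf.continuousOn]
  exact hτ.mono (cfc_mem hR _) (cfc_mem hR _) (cfc_nonneg fun x _ => hg0 x)
    (cfc_mono (fun x _ => hgf x) hg.continuousOn (hf.const_mul _).continuousOn)

theorem cfc_le_of_le_algebraMap_add_smul (hτ : IsNormalTrace N τ) {R p : H →L[ℂ] H} (hR : R ∈ N)
    (hRs : IsSelfAdjoint R) (hp : p ∈ N) (hpp : IsStarProjection p) {b M : ℝ} (hb : 0 < b)
    (hM : 0 ≤ M) (hle : R ≤ algebraMap ℝ (H →L[ℂ] H) b + M • p) {g : ℝ → ℝ} (hg : Continuous g)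
    (hg0 : ∀ x, 0 ≤ g x) {c : ℝ≥0} (hgc : ∀ x, g x ≤ c) (hgz : ∀ x ≤ 2 * b, g x = 0) :
    τ (cfc g R) ≤ 2 * c * τ p := by
  set k : ℝ → ℝ := fun x => √(x - b) / b with hk
  have hk0 : ∀ x, 0 ≤ k x ^ 2 * (x - b) := fun x => by
    rcases le_total x b with hx | hx
    · simp [hk, Real.sqrt_eq_zero_of_nonpos (sub_nonpos.2 hx)]
    · exact mul_nonneg (sq_nonneg _) (sub_nonneg.2 hx)
  set f : ℝ → ℝ := fun x => 1 - (1 + k x ^ 2 * (x - b))⁻¹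
  have hfc : Continuous f := continuous_const.sub
    ((by fun_prop : Continuous fun x => 1 + k x ^ 2 * (x - b)).inv₀
      fun x => (add_pos_of_pos_of_nonneg one_pos (hk0 x)).ne')
  have hf0 : ∀ x, 0 ≤ f x := fun x =>
    sub_nonneg.2 (inv_le_one_of_one_le₀ (le_add_of_nonneg_right (hk0 x)))
  have majorant : ∀ x, g x ≤ ((2 * c : ℝ≥0) : ℝ) * f x := by
    intro x
    rcases le_total x (2 * b) with hx | hx
    · rw [hgz x hx]
      exact mul_nonneg (by positivity) (hf0 x)
    · have hk1 : 1 ≤ k x ^ 2 * (x - b) := by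
        rw [hk, div_pow, Real.sq_sqrt (by linarith), div_mul_eq_mul_div, one_le_div (by positivity)]
        nlinarith
      have half : (1 + k x ^ 2 * (x - b))⁻¹ ≤ 2⁻¹ := inv_anti₀ two_pos (by linarith)
      calc g x ≤ c := hgc x
        _ = 2 * c * (1 - 2⁻¹) := by ring
        _ ≤ ((2 * c : ℝ≥0) : ℝ) * f x := by
          push_cast
          exact mul_le_mul_of_nonneg_left (sub_le_sub_left half 1) (by positivity)
  calc τ (cfc g R) ≤ (2 * c : ℝ≥0) * τ (cfc f R) :=
        hτ.cfc_le_nnreal_mul_cfc hR hfc hg hf0 hg0 majorant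
    _ ≤ (2 * c : ℝ≥0) * τ p := by
        gcongr
        exact hτ.cfc_one_sub_inv_le_of_le hR hRs hp hpp hM hle (by fun_prop) hk0
    _ = 2 * c * τ p := by norm_cast

end IsNormalTrace

/-! ### Singular values -/

theorem IsNormalTrace.cfc_realPart_le (hτ : IsNormalTrace N τ) {A p : H →L[ℂ] H} (hA : A ∈ N)
    (hp : p ∈ N) (hpp : IsStarProjection p) {r : ℝ} (hr : 0 < r) (hAp : ‖A * p‖ ≤ r) {g : ℝ → ℝ}
    (hg : Continuous g) (hg0 : ∀ x, 0 ≤ g x) {c : ℝ≥0} (hgc : ∀ x, g x ≤ c)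
    (hgz : ∀ x ≤ 4 * r, g x = 0) :
    τ (cfc g (ℜ A : H →L[ℂ] H)) ≤ 2 * c * τ (1 - p) :=
  hτ.cfc_le_of_le_algebraMap_add_smul (realPart_mem hA) (ℜ A).2 (sub_mem (one_mem N) hp)
    hpp.one_sub (by positivity) (by positivity) (realPart_le_of_norm_mul_le hpp hr hAp) hg hg0 hgc
    fun x hx => hgz x (by linarith)

theorem bddBelow_singularValue (N : VonNeumannAlgebra H) (τ : (H →L[ℂ] H) → ℝ≥0∞)
    (A : H →L[ℂ] H) (t : ℝ) :
    BddBelow {r : ℝ | ∃ p ∈ N, IsStarProjection p ∧ τ (1 - p) ≤ ENNReal.ofReal t ∧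
      r = ‖A * p‖} :=
  ⟨0, by rintro r ⟨p, -, -, -, rfl⟩; exact norm_nonneg _⟩

theorem singularValue_nonneg (N : VonNeumannAlgebra H) (τ : (H →L[ℂ] H) → ℝ≥0∞)
    (A : H →L[ℂ] H) (t : ℝ) : 0 ≤ singularValue N τ A t :=
  Real.sInf_nonneg (by rintro r ⟨p, -, -, -, rfl⟩; exact norm_nonneg _)

theorem singularValue_smul (N : VonNeumannAlgebra H) (τ : (H →L[ℂ] H) → ℝ≥0∞) (c : ℂ)
    (A : H →L[ℂ] H) (t : ℝ) : singularValue N τ (c • A) t = ‖c‖ * singularValue N τ A t := by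
  unfold singularValue
  rw [← smul_eq_mul, ← Real.sInf_smul_of_nonneg (norm_nonneg c)]
  congr 1
  ext r
  simp only [Set.mem_smul_set, Set.mem_ofPred_eq]
  constructor
  · rintro ⟨p, hp, hpp, h, rfl⟩
    exact ⟨_, ⟨p, hp, hpp, h, rfl⟩, by rw [smul_mul_assoc, norm_smul, smul_eq_mul]⟩
  · rintro ⟨_, ⟨p, hp, hpp, h, rfl⟩, rfl⟩
    exact ⟨p, hp, hpp, h, by rw [smul_mul_assoc, norm_smul, smul_eq_mul]⟩

theorem smul_mem_dixmierIdeal {A : H →L[ℂ] H} (hA : A ∈ dixmierIdeal N τ) (c : ℂ) :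
    c • A ∈ dixmierIdeal N τ := by
  obtain ⟨hN, C, hC⟩ := hA
  refine ⟨smul_mem hN c, ‖c‖ * C, fun t ht => ?_⟩
  simp only [singularValue_smul, intervalIntegral.integral_const_mul]
  rw [mul_left_comm]
  exact mul_le_mul_of_nonneg_left (hC t ht) (norm_nonneg c)

namespace IsNormalTrace

theorem norm_mem_singularValue (hτ : IsNormalTrace N τ) (A : H →L[ℂ] H) (t : ℝ) :
    ‖A‖ ∈ {r : ℝ | ∃ p ∈ N, IsStarProjection p ∧ τ (1 - p) ≤ ENNReal.ofReal t ∧ r = ‖A * p‖} :=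
  ⟨1, one_mem N, .one _, by rw [sub_self, hτ.map_zero]; exact zero_le, by rw [mul_one]⟩

theorem antitone_singularValue (hτ : IsNormalTrace N τ) (A : H →L[ℂ] H) :
    Antitone (singularValue N τ A) := by
  intro s t hst
  refine csInf_le_csInf (bddBelow_singularValue N τ A t) ⟨_, hτ.norm_mem_singularValue A s⟩ ?_
  rintro r ⟨p, hp, hpp, h, rfl⟩
  exact ⟨p, hp, hpp, h.trans (ENNReal.ofReal_le_ofReal hst), rfl⟩

theorem cfc_realPart_le_of_singularValue_lt (hτ : IsNormalTrace N τ) {A : H →L[ℂ] H}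
    (hA : A ∈ N) {r s : ℝ} (hrs : singularValue N τ A s < r) {g : ℝ → ℝ}
    (hg : Continuous g) (hg0 : ∀ x, 0 ≤ g x) {c : ℝ≥0} (hgc : ∀ x, g x ≤ c)
    (hgz : ∀ x ≤ 4 * r, g x = 0) :
    τ (cfc g (ℜ A : H →L[ℂ] H)) ≤ 2 * c * ENNReal.ofReal s := by
  obtain ⟨_, ⟨p, hp, hpp, hps, rfl⟩, hr⟩ :=
    exists_lt_of_csInf_lt ⟨_, hτ.norm_mem_singularValue A s⟩ hrs
  calc τ (cfc g (ℜ A : H →L[ℂ] H)) ≤ 2 * c * τ (1 - p) :=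
        hτ.cfc_realPart_le hA hp hpp ((norm_nonneg _).trans_lt hr) hr.le hg hg0 hgc hgz
    _ ≤ 2 * c * ENNReal.ofReal s := by gcongr

theorem cfc_realPart_le_volume (hτ : IsNormalTrace N τ) {A : H →L[ℂ] H} (hA : A ∈ N) {r : ℝ}
    {g : ℝ → ℝ} (hg : Continuous g) (hg0 : ∀ x, 0 ≤ g x) {c : ℝ≥0} (hgc : ∀ x, g x ≤ c)
    (hgz : ∀ x ≤ 4 * r, g x = 0) :
    τ (cfc g (ℜ A : H →L[ℂ] H)) ≤ 2 * c * volume {s : ℝ | 0 < s ∧ r ≤ singularValue N τ A s} := by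
  set V := volume {s : ℝ | 0 < s ∧ r ≤ singularValue N τ A s}
  rcases eq_or_ne c 0 with rfl | hc
  · have : g = 0 := funext fun x => le_antisymm (by simpa using hgc x) (hg0 x)
    simp [this, cfc_zero, hτ.map_zero]
  have h2c : (2 * c : ℝ≥0∞) ≠ 0 := by simpa using hc
  have h2c' : (2 * c : ℝ≥0∞) ≠ ∞ := ENNReal.mul_ne_top (by simp) (by simp)
  suffices h : τ (cfc g (ℜ A : H →L[ℂ] H)) / (2 * c) ≤ V by
    rwa [ENNReal.div_le_iff' h2c h2c'] at h
  refine le_of_forall_gt_imp_ge_of_dense fun v hv => ?_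
  rcases eq_or_ne v ∞ with rfl | hv'
  · exact le_top
  rw [ENNReal.div_le_iff' h2c h2c', ← ENNReal.ofReal_toReal hv']
  refine hτ.cfc_realPart_le_of_singularValue_lt hA (not_le.1 fun hle => hv.not_ge ?_) hg hg0 hgc hgz
  calc v = volume (Ioc 0 v.toReal) := by rw [Real.volume_Ioc, sub_zero, ENNReal.ofReal_toReal hv']
    _ ≤ V := measure_mono fun s hs => ⟨hs.1, hle.trans (hτ.antitone_singularValue A hs.2)⟩

end IsNormalTrace

/-! ### The trace of a spectral function as an integral over singular values -/

/-- The part of the increasing function `F` that is climbed while its argument moves from `b` up to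
`a`. -/
def layer (F : ℝ → ℝ) (a b x : ℝ) : ℝ := F (min a x) - F (min b x)

section Layer

variable {F : ℝ → ℝ} {a b x : ℝ}

theorem continuous_layer (hF : Continuous F) (a b : ℝ) : Continuous (layer F a b) := by
  unfold layer
  fun_prop

theorem layer_nonneg (hF : Monotone F) (hba : b ≤ a) (x : ℝ) : 0 ≤ layer F a b x :=
  sub_nonneg.2 (hF (min_le_min_right x hba))

theorem layer_of_le (hba : b ≤ a) (hx : x ≤ b) : layer F a b x = 0 := by
  rw [layer, min_eq_right hx, min_eq_right (hx.trans hba), sub_self]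

theorem layer_of_ge (hba : b ≤ a) (hx : a ≤ x) : layer F a b x = F a - F b := by
  rw [layer, min_eq_left hx, min_eq_left (hba.trans hx)]

theorem layer_le (hF : Monotone F) (hba : b ≤ a) (x : ℝ) : layer F a b x ≤ F a - F b := by
  rcases le_total x b with hx | hx
  · exact layer_of_le (F := F) hba hx ▸ sub_nonneg.2 (hF hba)
  · rw [layer, min_eq_left hx]
    exact sub_le_sub_right (hF (min_le_left a x)) _

theorem sum_layer (F : ℝ → ℝ) (a : ℕ → ℝ) (n : ℕ) :
    ∑ k ∈ Finset.range n, layer F (a k) (a (k + 1)) = layer F (a 0) (a n) := by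
  ext x
  rw [Finset.sum_apply]
  exact Finset.sum_range_sub' (fun k => F (min (a k) x)) n

theorem norm_cfc_layer_sub_le {E : Type*} [CStarAlgebra E] [PartialOrder E] [StarOrderedRing E]
    (hF : Continuous F) (hF0 : ∀ x, 0 ≤ F x) (hmono : Monotone F) {R : E} (hR : IsSelfAdjoint R)
    (ha : R ≤ algebraMap ℝ E a) (b : ℝ) :
    ‖cfc (layer F a b) R - cfc F R‖ ≤ F b := by
  rw [← cfc_sub _ _ R (continuous_layer hF a b).continuousOn hF.continuousOn]
  refine norm_cfc_le (hF0 b) fun x hx => ?_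
  have hxa : x ≤ a := (le_algebraMap_iff_spectrum_le hR).1 ha x hx
  rw [layer, min_eq_right hxa, sub_sub_cancel_left, norm_neg, Real.norm_of_nonneg (hF0 _)]
  exact hmono (min_le_left b x)

end Layer

namespace IsNormalTrace

variable {A : H →L[ℂ] H} {F : ℝ → ℝ}

theorem cfc_layer_realPart_le (hτ : IsNormalTrace N τ) (hA : A ∈ N) (hF : Continuous F)
    (hmono : Monotone F) {b : ℝ} (hb : 0 < b) :
    τ (cfc (layer F (2 * b) b) (ℜ A : H →L[ℂ] H)) ≤
      2 * ∫⁻ s in Ioi (0 : ℝ), ENNReal.ofReal (layer F (2 * b) b (8 * singularValue N τ A s)) := by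
  have hb2 : b ≤ 2 * b := by linarith
  set S := {s : ℝ | 0 < s ∧ b / 4 ≤ singularValue N τ A s}
  have hSm : MeasurableSet S := measurableSet_Ioi.inter
    (measurableSet_le measurable_const (hτ.antitone_singularValue A).measurable)
  have on_S : ∀ s ∈ S, ENNReal.ofReal (layer F (2 * b) b (8 * singularValue N τ A s)) =
      ENNReal.ofReal (F (2 * b) - F b) := fun s hs => by
    rw [layer_of_ge hb2 (by linarith [hs.2])]
  calc τ (cfc (layer F (2 * b) b) (ℜ A : H →L[ℂ] H))
      ≤ 2 * ENNReal.ofReal (F (2 * b) - F b) * volume S :=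
        hτ.cfc_realPart_le_volume hA (continuous_layer hF _ _) (layer_nonneg hmono hb2)
          (fun x => (layer_le hmono hb2 x).trans (Real.le_coe_toNNReal _))
          fun x hx => layer_of_le hb2 (by linarith)
    _ = 2 * ∫⁻ s in S, ENNReal.ofReal (layer F (2 * b) b (8 * singularValue N τ A s)) := by
        rw [setLIntegral_congr_fun hSm on_S, setLIntegral_const, mul_assoc]
    _ ≤ _ := by
        gcongr
        exact fun s hs => hs.1

theorem cfc_realPart_le_lintegral_of_layer (hτ : IsNormalTrace N τ) (hA : A ∈ N) (hF : Continuous F)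
    (hmono : Monotone F) (hF0 : ∀ x, 0 ≤ F x) {a : ℕ → ℝ} (ha : ∀ n, 0 < a n)
    (ha2 : ∀ n, a n = 2 * a (n + 1)) (n : ℕ) :
    τ (cfc (layer F (a 0) (a n)) (ℜ A : H →L[ℂ] H)) ≤
      2 * ∫⁻ s in Ioi (0 : ℝ), ENNReal.ofReal (F (8 * singularValue N τ A s)) := by
  have hle : ∀ k, a (k + 1) ≤ a k := fun k => by linarith [ha2 k, ha (k + 1)]
  have hν : Measurable fun s => 8 * singularValue N τ A s :=
    (hτ.antitone_singularValue A).measurable.const_mul 8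
  rw [← sum_layer, cfc_sum _ _ _ fun k _ => (continuous_layer hF _ _).continuousOn,
    hτ.map_sum _ (fun k => cfc_mem (realPart_mem hA) _)
      fun k => cfc_nonneg fun x _ => layer_nonneg hmono (hle k) x]
  calc ∑ k ∈ Finset.range n, τ (cfc (layer F (a k) (a (k + 1))) (ℜ A : H →L[ℂ] H))
      ≤ ∑ k ∈ Finset.range n, 2 * ∫⁻ s in Ioi (0 : ℝ),
          ENNReal.ofReal (layer F (a k) (a (k + 1)) (8 * singularValue N τ A s)) :=
        Finset.sum_le_sum fun k _ => by
          rw [ha2 k]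
          exact hτ.cfc_layer_realPart_le hA hF hmono (ha (k + 1))
    _ = 2 * ∫⁻ s in Ioi (0 : ℝ),
          ENNReal.ofReal (layer F (a 0) (a n) (8 * singularValue N τ A s)) := by
        rw [← Finset.mul_sum, ← lintegral_finsetSum]
        · simp_rw [← sum_layer F a n, Finset.sum_apply,
            ENNReal.ofReal_sum_of_nonneg fun k _ => layer_nonneg hmono (hle k) _]
        · exact fun k _ => ((continuous_layer hF _ _).measurable.comp hν).ennreal_ofReal
    _ ≤ _ := by
        gcongr with s
        exact (sub_le_self _ (hF0 _)).trans (hmono (min_le_right _ _))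

theorem cfc_realPart_le_lintegral (hτ : IsNormalTrace N τ) (hA : A ∈ N) (hF : Continuous F)
    (hmono : Monotone F) (hFz : ∀ x ≤ 0, F x = 0) :
    τ (cfc F (ℜ A : H →L[ℂ] H)) ≤
      2 * ∫⁻ s in Ioi (0 : ℝ), ENNReal.ofReal (F (8 * singularValue N τ A s)) := by
  set R := (ℜ A : H →L[ℂ] H)
  set a : ℕ → ℝ := fun n => (‖R‖ + 1) * (1 / 2) ^ n with ha
  have hR : R ≤ algebraMap ℝ _ (a 0) := (IsSelfAdjoint.le_algebraMap_norm_self (ℜ A).2).trans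
    (algebraMap_mono _ (by simp [ha, R]))
  have ha0 : ∀ n, 0 < a n := fun n => by positivity
  have ha2 : ∀ n, a n = 2 * a (n + 1) := fun n => by simp only [ha, pow_succ]; ring
  have ha_anti : Antitone a := antitone_nat_of_succ_le fun n => by linarith [ha2 n, ha0 (n + 1)]
  have ha_lim : Tendsto a atTop (𝓝 0) := by
    simpa only [mul_zero] using (tendsto_pow_atTop_nhds_zero_of_lt_one (by norm_num)
      (by norm_num : (1 / 2 : ℝ) < 1)).const_mul (‖R‖ + 1)
  have hF0 : ∀ x, 0 ≤ F x := fun x =>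
    (hFz _ (min_le_right x 0)).symm.trans_le (hmono (min_le_left x 0))
  have lim : Tendsto (fun n => cfc (layer F (a 0) (a n)) R) atTop (𝓝 (cfc F R)) := by
    refine tendsto_iff_norm_sub_tendsto_zero.2 (squeeze_zero (fun n => norm_nonneg _) (fun n =>
      norm_cfc_layer_sub_le hF hF0 hmono (ℜ A).2 hR (a n)) ?_)
    exact hFz 0 le_rfl ▸ (hF.tendsto 0).comp ha_lim
  have mono : Monotone fun n => cfc (layer F (a 0) (a n)) R := fun m n hmn =>
    cfc_mono (fun x _ => sub_le_sub_left (hmono (min_le_min_right x (ha_anti hmn))) _)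
      (continuous_layer hF _ _).continuousOn (continuous_layer hF _ _).continuousOn
  rw [hτ.eq_iSup_of_tendsto (fun n => cfc_mem (realPart_mem hA) _)
    (fun n => cfc_nonneg fun x _ => layer_nonneg hmono (ha_anti n.zero_le) x) mono
    (cfc_mem (realPart_mem hA) _) lim]
  exact iSup_le (hτ.cfc_realPart_le_lintegral_of_layer hA hF hmono hF0 ha0 ha2)

end IsNormalTrace

/-! ### Integrals of cutoffs of decreasing functions with logarithmic primitive -/

/-- A decreasing nonnegative function with `∫_0^t ν ≤ C log (1 + t)`. The singular value function of
an element of the Dixmier ideal is of this kind. -/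
structure HasLogPrimitive (ν : ℝ → ℝ) (C : ℝ) : Prop where
  antitone : Antitone ν
  nonneg : ∀ s, 0 ≤ ν s
  integral_le : ∀ t, 0 < t → ∫ s in (0 : ℝ)..t, ν s ≤ C * Real.log (1 + t)

/-- A continuous increasing function from `0` to at most `1`, supported on the positive axis and
vanishing there to fourth order at `0`, with constant `K`. The order is chosen so that `F ∘ ν` is
integrable at infinity when `∫_0^t ν = O(log t)`, through the crude bound
`ν s = O(s ^ (-1 / 2))`. -/
structure IsCutoff (F : ℝ → ℝ) (K : ℝ) : Prop where
  continuous : Continuous F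
  monotone : Monotone F
  eq_zero : ∀ x ≤ 0, F x = 0
  le_one : ∀ x, F x ≤ 1
  le_mul_pow : ∀ x, F x ≤ K * x ^ 4

theorem log_one_add_le_two_mul_sqrt {s : ℝ} (hs : 0 < s) : Real.log (1 + s) ≤ 2 * √s := by
  have sqrt_le : √(1 + s) ≤ 1 + √s := by
    rw [Real.sqrt_le_left (by positivity)]
    nlinarith [Real.sq_sqrt hs.le, Real.sqrt_nonneg s]
  calc Real.log (1 + s) = 2 * Real.log √(1 + s) := by rw [Real.log_sqrt (by positivity)]; ring
    _ ≤ 2 * (√(1 + s) - 1) := by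
        gcongr
        exact Real.log_le_sub_one_of_pos (by positivity)
    _ ≤ 2 * √s := by linarith

theorem lintegral_Ioi_inv_sq {X : ℝ} (hX : 0 < X) :
    ∫⁻ s in Ioi X, ENNReal.ofReal (s ^ 2)⁻¹ = ENNReal.ofReal X⁻¹ := by
  have rpow_eq : ∀ s ∈ Ioi X, (s ^ 2)⁻¹ = s ^ (-2 : ℝ) := fun s hs => by
    rw [Real.rpow_neg (hX.trans hs).le]
    norm_cast
  rw [setLIntegral_congr_fun measurableSet_Ioi fun s hs => by rw [rpow_eq s hs],
    ← ofReal_integral_eq_lintegral_ofReal (integrableOn_Ioi_rpow_of_lt (by norm_num) hX),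
    integral_Ioi_rpow_of_lt (by norm_num) hX]
  · norm_num [Real.rpow_neg_one]
  · filter_upwards [ae_restrict_mem measurableSet_Ioi] with s hs
    exact Real.rpow_nonneg (hX.trans hs).le _

namespace HasLogPrimitive

variable {ν : ℝ → ℝ} {C : ℝ}

theorem const_nonneg (hν : HasLogPrimitive ν C) : 0 ≤ C := by
  have h := (intervalIntegral.integral_nonneg zero_le_one fun s _ => hν.nonneg s).trans
    (hν.integral_le 1 one_pos)
  exact nonneg_of_mul_nonneg_left h (Real.log_pos (by norm_num))

theorem const_mul (hν : HasLogPrimitive ν C) {a : ℝ} (ha : 0 ≤ a) :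
    HasLogPrimitive (fun s => a * ν s) (a * C) where
  antitone := hν.antitone.const_mul ha
  nonneg s := mul_nonneg ha (hν.nonneg s)
  integral_le t ht := by
    rw [intervalIntegral.integral_const_mul, mul_assoc]
    exact mul_le_mul_of_nonneg_left (hν.integral_le t ht) ha

theorem pow_four_le (hν : HasLogPrimitive ν C) {s : ℝ} (hs : 0 < s) :
    ν s ^ 4 ≤ 16 * C ^ 4 * (s ^ 2)⁻¹ := by
  have weak : s * ν s ≤ C * (2 * √s) := by
    calc s * ν s = ∫ _x in (0 : ℝ)..s, ν s := by simp
      _ ≤ ∫ x in (0 : ℝ)..s, ν x :=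
          intervalIntegral.integral_mono_on hs.le (by simp) hν.antitone.intervalIntegrable
            fun x hx => hν.antitone hx.2
      _ ≤ C * Real.log (1 + s) := hν.integral_le s hs
      _ ≤ C * (2 * √s) :=
          mul_le_mul_of_nonneg_left (log_one_add_le_two_mul_sqrt hs) hν.const_nonneg
  have sqrt_pow : √s ^ 4 = s ^ 2 := by
    rw [show √s ^ 4 = (√s ^ 2) ^ 2 by ring, Real.sq_sqrt hs.le]
  calc ν s ^ 4 = (s * ν s) ^ 4 / s ^ 4 := by field_simp
    _ ≤ (C * (2 * √s)) ^ 4 / s ^ 4 := by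
        gcongr
        exact mul_nonneg hs.le (hν.nonneg s)
    _ = 16 * C ^ 4 * (s ^ 2)⁻¹ := by
        rw [mul_pow, mul_pow, sqrt_pow]
        field_simp
        norm_num

theorem lintegral_pow_four_Ioi_le (hν : HasLogPrimitive ν C) {X : ℝ} (hX : 0 < X) :
    ∫⁻ s in Ioi X, ENNReal.ofReal (ν s ^ 4) ≤ ENNReal.ofReal (16 * C ^ 4 * X⁻¹) := by
  have hC : 0 ≤ 16 * C ^ 4 := by have := hν.const_nonneg; positivity
  rw [ENNReal.ofReal_mul hC, ← lintegral_Ioi_inv_sq hX,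
    ← lintegral_const_mul' _ _ ENNReal.ofReal_ne_top]
  refine setLIntegral_mono' measurableSet_Ioi fun s hs => ?_
  rw [← ENNReal.ofReal_mul hC]
  exact ENNReal.ofReal_le_ofReal (hν.pow_four_le (hX.trans hs))

theorem lintegral_pow_four_ne_top (hν : HasLogPrimitive ν C) :
    ∫⁻ s in Ioi (0 : ℝ), ENNReal.ofReal (ν s ^ 4) ≠ ∞ := by
  rw [← Ioc_union_Ioi_eq_Ioi zero_le_one, lintegral_union measurableSet_Ioi
    (Ioc_disjoint_Ioi le_rfl)]
  refine ENNReal.add_ne_top.2 ⟨ne_top_of_le_ne_top ?_ (setLIntegral_mono' measurableSet_Ioc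
    fun s hs => ENNReal.ofReal_le_ofReal (pow_le_pow_left₀ (hν.nonneg s) (hν.antitone hs.1.le) 4)),
    ne_top_of_le_ne_top ENNReal.ofReal_ne_top (hν.lintegral_pow_four_Ioi_le one_pos)⟩
  simp

end HasLogPrimitive

namespace IsCutoff

variable {F : ℝ → ℝ} {K : ℝ}

theorem nonneg (hF : IsCutoff F K) (x : ℝ) : 0 ≤ F x :=
  (hF.eq_zero _ (min_le_right x 0)).symm.trans_le (hF.monotone (min_le_left x 0))

theorem const_nonneg (hF : IsCutoff F K) : 0 ≤ K := by
  simpa using (hF.nonneg 1).trans (hF.le_mul_pow 1)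

theorem le_sq_mul_inv_one_add_sq (hF : IsCutoff F K) (x : ℝ) :
    F x ≤ 2 * (K + 1) * (x ^ 2 * (1 + x ^ 2)⁻¹) := by
  have hK := hF.const_nonneg
  rw [← mul_assoc, le_mul_inv_iff₀ (by positivity)]
  rcases le_total (x ^ 2) 1 with hx | hx
  · have : F x ≤ K * x ^ 2 := (hF.le_mul_pow x).trans
      (mul_le_mul_of_nonneg_left (by nlinarith [sq_nonneg x]) hK)
    nlinarith [hF.nonneg x, mul_nonneg hK (sq_nonneg x)]
  · nlinarith [mul_le_mul_of_nonneg_right (hF.le_one x) (by positivity : 0 ≤ 1 + x ^ 2),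
      mul_nonneg hK (sq_nonneg x)]

theorem lintegral_comp_mul_div_sq_le (hF : IsCutoff F K) {a : ℝ} (ha : 0 ≤ a) :
    ∫⁻ t in Ioi 1, ENNReal.ofReal (F (t * a) * (t ^ 2)⁻¹) ≤
      ENNReal.ofReal (2 * (K + 1) * Real.pi * a) := by
  rcases ha.eq_or_lt with rfl | ha
  · simp [hF.eq_zero]
  have hK := hF.const_nonneg
  have hint : Integrable fun t : ℝ => 2 * (K + 1) * a ^ 2 * (1 + (a * t) ^ 2)⁻¹ :=
    (integrable_inv_one_add_sq.comp_mul_left' ha.ne').const_mul _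
  calc ∫⁻ t in Ioi 1, ENNReal.ofReal (F (t * a) * (t ^ 2)⁻¹)
      ≤ ∫⁻ t in Ioi 1, ENNReal.ofReal (2 * (K + 1) * a ^ 2 * (1 + (a * t) ^ 2)⁻¹) := by
        refine setLIntegral_mono' measurableSet_Ioi fun t ht => ENNReal.ofReal_le_ofReal ?_
        have ht0 : 0 < t := one_pos.trans ht
        calc F (t * a) * (t ^ 2)⁻¹
            ≤ 2 * (K + 1) * ((t * a) ^ 2 * (1 + (t * a) ^ 2)⁻¹) * (t ^ 2)⁻¹ := by
              gcongr
              exact hF.le_sq_mul_inv_one_add_sq _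
          _ = 2 * (K + 1) * a ^ 2 * (1 + (a * t) ^ 2)⁻¹ := by rw [mul_comm t a]; field_simp
    _ ≤ ∫⁻ t, ENNReal.ofReal (2 * (K + 1) * a ^ 2 * (1 + (a * t) ^ 2)⁻¹) :=
        setLIntegral_le_lintegral _ _
    _ = ENNReal.ofReal (∫ t, 2 * (K + 1) * a ^ 2 * (1 + (a * t) ^ 2)⁻¹) :=
        (ofReal_integral_eq_lintegral_ofReal hint (.of_forall fun t => by positivity)).symm
    _ = ENNReal.ofReal (2 * (K + 1) * Real.pi * a) := by
        rw [integral_const_mul, Measure.integral_comp_mul_left (fun t : ℝ => (1 + t ^ 2)⁻¹) a,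
          integral_univ_inv_one_add_sq, abs_of_pos (inv_pos.2 ha), smul_eq_mul]
        congr 1
        field_simp

variable {ν : ℝ → ℝ} {C : ℝ}

theorem lintegral_comp_mul_le (hF : IsCutoff F K) (ν : ℝ → ℝ) (t : ℝ) (S : Set ℝ) :
    ∫⁻ s in S, ENNReal.ofReal (F (t * ν s)) ≤
      ENNReal.ofReal (K * t ^ 4) * ∫⁻ s in S, ENNReal.ofReal (ν s ^ 4) := by
  have hK := hF.const_nonneg
  rw [← lintegral_const_mul' _ _ ENNReal.ofReal_ne_top]
  gcongr with s
  rw [← ENNReal.ofReal_mul (by positivity)]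
  exact ENNReal.ofReal_le_ofReal ((hF.le_mul_pow _).trans_eq (by ring))

theorem lintegral_lintegral_Ioc_le (hF : IsCutoff F K) (hν : HasLogPrimitive ν C) (T : ℝ) {X : ℝ}
    (hX : 0 < X) :
    ∫⁻ t in Ioc 1 T, (∫⁻ s in Ioc 0 X, ENNReal.ofReal (F (t * ν s))) * ENNReal.ofReal (t ^ 2)⁻¹ ≤
      ENNReal.ofReal (2 * (K + 1) * Real.pi * (C * Real.log (1 + X))) := by
  have hK := hF.const_nonneg
  have hm := hF.continuous.measurable
  have hνm := hν.antitone.measurable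
  have hint : IntervalIntegrable ν volume 0 X := hν.antitone.intervalIntegrable
  calc ∫⁻ t in Ioc 1 T, (∫⁻ s in Ioc 0 X, ENNReal.ofReal (F (t * ν s))) * ENNReal.ofReal (t ^ 2)⁻¹
      = ∫⁻ t in Ioc 1 T, ∫⁻ s in Ioc 0 X, ENNReal.ofReal (F (t * ν s) * (t ^ 2)⁻¹) := by
        simp_rw [ENNReal.ofReal_mul (hF.nonneg _), lintegral_mul_const' _ _ ENNReal.ofReal_ne_top]
    _ = ∫⁻ s in Ioc 0 X, ∫⁻ t in Ioc 1 T, ENNReal.ofReal (F (t * ν s) * (t ^ 2)⁻¹) :=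
        lintegral_lintegral_swap (Measurable.aemeasurable (by fun_prop))
    _ ≤ ∫⁻ s in Ioc 0 X, ENNReal.ofReal (2 * (K + 1) * Real.pi * ν s) := by
        gcongr with s
        exact (lintegral_mono_set Ioc_subset_Ioi_self).trans
          (hF.lintegral_comp_mul_div_sq_le (hν.nonneg s))
    _ = ENNReal.ofReal (2 * (K + 1) * Real.pi * ∫ s in (0 : ℝ)..X, ν s) := by
        rw [← intervalIntegral.integral_const_mul, intervalIntegral.integral_of_le hX.le,
          ofReal_integral_eq_lintegral_ofReal (hint.1.const_mul _)]
        exact .of_forall fun s => mul_nonneg (by positivity) (hν.nonneg s)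
    _ ≤ _ := by
        gcongr
        exact hν.integral_le X hX

theorem lintegral_lintegral_Ioi_le (hF : IsCutoff F K) (hν : HasLogPrimitive ν C) {T : ℝ}
    (hT : 1 ≤ T) :
    ∫⁻ t in Ioc 1 T, (∫⁻ s in Ioi (T ^ 4), ENNReal.ofReal (F (t * ν s))) *
      ENNReal.ofReal (t ^ 2)⁻¹ ≤ ENNReal.ofReal (16 * K * C ^ 4) := by
  have hK := hF.const_nonneg
  have _ := hν.const_nonneg
  have inner_le : ∀ t ∈ Ioc 1 T, ∫⁻ s in Ioi (T ^ 4), ENNReal.ofReal (F (t * ν s)) ≤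
      ENNReal.ofReal (16 * K * C ^ 4) := fun t ht => by
    have ht0 : 0 < t := one_pos.trans ht.1
    calc ∫⁻ s in Ioi (T ^ 4), ENNReal.ofReal (F (t * ν s))
        ≤ ENNReal.ofReal (K * T ^ 4) * ENNReal.ofReal (16 * C ^ 4 * (T ^ 4)⁻¹) := by
          refine (hF.lintegral_comp_mul_le ν t _).trans ?_
          gcongr
          · exact ht.2
          · exact hν.lintegral_pow_four_Ioi_le (by positivity)
      _ = ENNReal.ofReal (16 * K * C ^ 4) := by
          rw [← ENNReal.ofReal_mul (by positivity)]
          congr 1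
          field_simp
  calc ∫⁻ t in Ioc 1 T, (∫⁻ s in Ioi (T ^ 4), ENNReal.ofReal (F (t * ν s))) *
        ENNReal.ofReal (t ^ 2)⁻¹
      ≤ ∫⁻ t in Ioc 1 T, ENNReal.ofReal (16 * K * C ^ 4) * ENNReal.ofReal (t ^ 2)⁻¹ :=
        setLIntegral_mono' measurableSet_Ioc fun t ht => by gcongr; exact inner_le t ht
    _ ≤ ENNReal.ofReal (16 * K * C ^ 4) * ∫⁻ t in Ioi 1, ENNReal.ofReal (t ^ 2)⁻¹ := by
        rw [lintegral_const_mul' _ _ ENNReal.ofReal_ne_top]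
        gcongr
        exact Ioc_subset_Ioi_self
    _ = ENNReal.ofReal (16 * K * C ^ 4) := by simp [lintegral_Ioi_inv_sq one_pos]

theorem exists_lintegral_lintegral_le (hF : IsCutoff F K) (hν : HasLogPrimitive ν C) :
    ∃ D : ℝ, ∀ T, Real.exp 1 ≤ T →
      ∫⁻ t in Ioc 1 T, (∫⁻ s in Ioi 0, ENNReal.ofReal (F (t * ν s))) * ENNReal.ofReal (t ^ 2)⁻¹ ≤
        ENNReal.ofReal (D * Real.log T) := by
  have hK := hF.const_nonneg
  have hC := hν.const_nonneg
  refine ⟨2 * (K + 1) * Real.pi * (C * 5) + 16 * K * C ^ 4, fun T hT => ?_⟩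
  have hT2 : 2 ≤ T := by linarith [Real.add_one_le_exp 1]
  have log_T : 1 ≤ Real.log T := (Real.le_log_iff_exp_le (by linarith)).2 hT
  have log_le : Real.log (1 + T ^ 4) ≤ 5 * Real.log T := by
    rw [show 5 * Real.log T = Real.log (T ^ 5) by rw [Real.log_pow]; norm_num]
    have : 1 ≤ T ^ 4 := one_le_pow₀ (by linarith)
    exact Real.log_le_log (by positivity) (by nlinarith [pow_succ T 4])
  have split : ∀ t, (∫⁻ s in Ioi 0, ENNReal.ofReal (F (t * ν s))) * ENNReal.ofReal (t ^ 2)⁻¹ =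
      (∫⁻ s in Ioc 0 (T ^ 4), ENNReal.ofReal (F (t * ν s))) * ENNReal.ofReal (t ^ 2)⁻¹ +
      (∫⁻ s in Ioi (T ^ 4), ENNReal.ofReal (F (t * ν s))) * ENNReal.ofReal (t ^ 2)⁻¹ := fun t => by
    rw [← add_mul, ← lintegral_union measurableSet_Ioi (Ioc_disjoint_Ioi le_rfl),
      Ioc_union_Ioi_eq_Ioi (by positivity)]
  have hmeas : Measurable fun t =>
      (∫⁻ s in Ioi (T ^ 4), ENNReal.ofReal (F (t * ν s))) * ENNReal.ofReal (t ^ 2)⁻¹ := by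
    have hFm := hF.continuous.measurable
    have hνm := hν.antitone.measurable
    have hpair : Measurable fun p : ℝ × ℝ => ENNReal.ofReal (F (p.1 * ν p.2)) := by fun_prop
    exact hpair.lintegral_prod_right'.mul (by fun_prop)
  simp_rw [split]
  rw [lintegral_add_right _ hmeas]
  calc _ ≤ ENNReal.ofReal (2 * (K + 1) * Real.pi * (C * Real.log (1 + T ^ 4))) +
        ENNReal.ofReal (16 * K * C ^ 4) :=
        add_le_add (hF.lintegral_lintegral_Ioc_le hν T (by positivity))
          (hF.lintegral_lintegral_Ioi_le hν (by linarith))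
    _ ≤ ENNReal.ofReal (2 * (K + 1) * Real.pi * (C * (5 * Real.log T))) +
        ENNReal.ofReal (16 * K * C ^ 4 * Real.log T) := by
        refine add_le_add ?_ (ENNReal.ofReal_le_ofReal ?_)
        · gcongr
        · exact le_mul_of_one_le_right (by positivity) log_T
    _ = _ := by
        rw [← ENNReal.ofReal_add (by positivity) (by positivity)]
        congr 1
        ring

end IsCutoff

/-! ### The function `exp (-x ^ (-q))` -/

theorem expNegPow_nonneg (q x : ℝ) : 0 ≤ expNegPow q x := by
  unfold expNegPow; split_ifs <;> positivity

theorem expNegPow_of_nonpos (q : ℝ) {x : ℝ} (hx : x ≤ 0) : expNegPow q x = 0 :=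
  if_neg (not_lt.2 hx)

theorem expNegPow_le_one (q x : ℝ) : expNegPow q x ≤ 1 := by
  unfold expNegPow
  split_ifs with h
  · exact Real.exp_le_one_iff.2 (neg_nonpos.2 (Real.rpow_nonneg h.le _))
  · exact zero_le_one

theorem monotone_expNegPow {q : ℝ} (hq : 0 < q) : Monotone (expNegPow q) := by
  intro x y hxy
  rcases le_or_gt x 0 with h | h
  · rw [expNegPow_of_nonpos q h]; exact expNegPow_nonneg q y
  · rw [expNegPow, expNegPow, if_pos h, if_pos (h.trans_le hxy), Real.exp_le_exp, neg_le_neg_iff]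
    exact Real.rpow_le_rpow_of_nonpos h hxy (by linarith)

theorem exists_expNegPow_le_mul_pow {q : ℝ} (hq : 0 < q) {n : ℕ} (hn : Even n) :
    ∃ K : ℝ, ∀ x, expNegPow q x ≤ K * x ^ n := by
  obtain ⟨j, hj⟩ := exists_nat_ge (n / q)
  have hjq : n ≤ q * j := by rwa [div_le_iff₀' hq] at hj
  have one_le : (1 : ℝ) ≤ j.factorial := by exact_mod_cast j.factorial_pos
  refine ⟨j.factorial, fun x => ?_⟩
  rcases le_or_gt x 0 with hx | hx
  · rw [expNegPow_of_nonpos q hx]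
    exact mul_nonneg (by positivity) (hn.pow_nonneg x)
  rcases le_or_gt 1 x with h1 | h1
  · exact (expNegPow_le_one q x).trans (one_le_mul_of_one_le_of_one_le one_le (one_le_pow₀ h1))
  set v := x ^ (-q) with hv
  have hv0 : 0 < v := Real.rpow_pos_of_pos hx _
  have v_pow : 1 ≤ v ^ j * x ^ n := by
    rw [hv, ← Real.rpow_natCast, ← Real.rpow_natCast, ← Real.rpow_mul hx.le, ← Real.rpow_add hx]
    exact Real.one_le_rpow_of_pos_of_le_one_of_nonpos hx h1.le (by linarith)
  rw [expNegPow, if_pos hx, Real.exp_neg, inv_le_iff_one_le_mul₀ (Real.exp_pos _)]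
  calc (1 : ℝ) ≤ v ^ j * x ^ n := v_pow
    _ = j.factorial * x ^ n * (v ^ j / j.factorial) := by field_simp
    _ ≤ j.factorial * x ^ n * Real.exp v := by
        gcongr
        exact Real.pow_div_factorial_le_exp v hv0.le j

theorem continuous_expNegPow {q : ℝ} (hq : 0 < q) : Continuous (expNegPow q) := by
  refine continuous_iff_continuousAt.2 fun x => ?_
  rcases lt_trichotomy x 0 with h | rfl | h
  · refine continuousAt_const.congr (f := fun _ => 0) ?_
    filter_upwards [gt_mem_nhds h] with y hy using (expNegPow_of_nonpos q hy.le).symm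
  · obtain ⟨K, hK⟩ := exists_expNegPow_le_mul_pow hq even_two
    have hlim : Tendsto (fun x : ℝ => K * x ^ 2) (𝓝 0) (𝓝 0) := by
      simpa using (by fun_prop : Continuous fun x : ℝ => K * x ^ 2).tendsto 0
    rw [ContinuousAt, expNegPow_of_nonpos q le_rfl]
    exact squeeze_zero (expNegPow_nonneg q) hK hlim
  · refine (Real.continuousAt_rpow_const x (-q) (.inl h.ne')).neg.rexp.congr ?_
    filter_upwards [lt_mem_nhds h] with y hy using (if_pos hy).symm

theorem exists_isCutoff_expNegPow {q : ℝ} (hq : 0 < q) : ∃ K, IsCutoff (expNegPow q) K :=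
  (exists_expNegPow_le_mul_pow hq (n := 4) (by decide)).imp fun _ hK =>
    ⟨continuous_expNegPow hq, monotone_expNegPow hq, fun _ => expNegPow_of_nonpos q,
      expNegPow_le_one q, hK⟩

/-! ### Generalised limits -/

theorem tendsto_scale_atTop (s : ℝ) (hs : 0 < s) : Tendsto (scale s hs) atTop atTop := by
  refine tendsto_atTop.2 fun b => ?_
  filter_upwards [eventually_ge_atTop (⟨b.1 * s, mul_pos b.2 hs⟩ : SemiAxis)] with t ht
  exact (le_div_iff₀ hs).2 ht

theorem const_mem_LInfty (c : ℝ) : (fun _ => c : SemiAxis → ℝ) ∈ LInfty :=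
  ⟨aemeasurable_const, |c|, fun _ => le_rfl⟩

theorem posPart_mem_LInfty (z : LInfty) : (fun t => max (z.1 t) 0) ∈ LInfty :=
  ⟨z.2.1.max aemeasurable_const, z.2.2.imp fun C hC t => by
    rw [abs_of_nonneg (le_max_right _ _)]
    exact max_le ((le_abs_self _).trans (hC t)) ((abs_nonneg _).trans (hC t))⟩

namespace IsGeneralisedLimit

variable {γ : LInfty →ₗ[ℝ] ℝ}

theorem map_const (hγ : IsGeneralisedLimit γ) (c : ℝ) : γ ⟨fun _ => c, const_mem_LInfty c⟩ = c := by
  have smul_one : (⟨fun _ => c, const_mem_LInfty c⟩ : LInfty) =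
      c • ⟨fun _ => 1, const_mem_LInfty 1⟩ := Subtype.ext (funext fun _ => (mul_one c).symm)
  rw [smul_one, map_smul, hγ.normalised _ fun _ => rfl, smul_eq_mul, mul_one]

theorem mono (hγ : IsGeneralisedLimit γ) {z w : LInfty} (h : ∀ t, z.1 t ≤ w.1 t) : γ z ≤ γ w :=
  sub_nonneg.1 (map_sub γ w z ▸ hγ.nonneg (w - z) fun t => sub_nonneg.2 (h t))

theorem abs_apply_le (hγ : IsGeneralisedLimit γ) {z : LInfty} {C : ℝ} (h : ∀ t, |z.1 t| ≤ C) :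
    |γ z| ≤ C :=
  abs_le.2 ⟨(hγ.map_const (-C)).symm.trans_le (hγ.mono fun t => (abs_le.1 (h t)).1),
    (hγ.mono fun t => (abs_le.1 (h t)).2).trans_eq (hγ.map_const C)⟩

theorem le_of_eventually_le_add (hγ : IsGeneralisedLimit γ) {z w : LInfty}
    (h : ∀ ε : ℝ, 0 < ε → ∀ᶠ t in atTop, z.1 t ≤ w.1 t + ε) : γ z ≤ γ w := by
  set y : LInfty := ⟨_, posPart_mem_LInfty (z - w)⟩
  have y_lim : Tendsto y.1 atTop (𝓝 0) := by
    refine tendsto_order.2 ⟨fun a ha => .of_forall fun t => ha.trans_le (le_max_right _ _),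
      fun a ha => ?_⟩
    filter_upwards [h (a / 2) (half_pos ha)] with t ht
    have hsub : (z - w).1 t ≤ a / 2 := sub_le_iff_le_add'.2 ht
    exact max_lt (by linarith) ha
  have := hγ.mono (z := z - w) (w := y) fun t => le_max_left _ _
  rwa [hγ.vanish y y_lim, map_sub, sub_nonpos] at this

theorem comp_dilation (hγ : IsGeneralisedLimit γ) (s : ℝ) (hs : 0 < s) :
    IsGeneralisedLimit (γ ∘ₗ dilation s hs) where
  nonneg _ hz := hγ.nonneg _ fun _ => hz _
  normalised _ hz := hγ.normalised _ fun _ => hz _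
  vanish _ hz := hγ.vanish _ (hz.comp (tendsto_scale_atTop s hs))

theorem exists_tendsto_ultrafilter {ι : Type*} (U : Ultrafilter ι) {φ : ι → LInfty →ₗ[ℝ] ℝ}
    (hφ : ∀ i, IsGeneralisedLimit (φ i)) :
    ∃ ψ : LInfty →ₗ[ℝ] ℝ, IsGeneralisedLimit ψ ∧ ∀ z, Tendsto (fun i => φ i z) U (𝓝 (ψ z)) := by
  have hex : ∀ z : LInfty, ∃ l : ℝ, Tendsto (fun i => φ i z) U (𝓝 l) := fun z => by
    obtain ⟨C, hC⟩ := z.2.2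
    obtain ⟨l, -, hl⟩ := (isCompact_Icc (a := -C) (b := C)).ultrafilter_le_nhds
      (U.map fun i => φ i z) (le_principal_iff.2 (Ultrafilter.mem_map.2
        (univ_mem' fun i => abs_le.1 ((hφ i).abs_apply_le hC))))
    exact ⟨l, hl⟩
  choose ψ hψ using hex
  have map_add (z w) : ψ (z + w) = ψ z + ψ w :=
    tendsto_nhds_unique (hψ _) (by simpa only [_root_.map_add] using (hψ z).add (hψ w))
  have map_smul (c : ℝ) (z) : ψ (c • z) = c • ψ z :=
    tendsto_nhds_unique (hψ _) (by simpa only [_root_.map_smul] using (hψ z).const_smul c)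
  refine ⟨⟨⟨ψ, map_add⟩, map_smul⟩, ⟨fun z hz => ?_, fun z hz => ?_, fun z hz => ?_⟩, hψ⟩
  · exact ge_of_tendsto' (hψ z) fun i => (hφ i).nonneg z hz
  · exact tendsto_nhds_unique (hψ z) (tendsto_const_nhds.congr fun i =>
      ((hφ i).normalised z hz).symm)
  · exact tendsto_nhds_unique (hψ z) (tendsto_const_nhds.congr fun i => ((hφ i).vanish z hz).symm)

end IsGeneralisedLimit

/-! ### Sliding logarithmic means -/

/-- Translation by `v` of the variable `log t`, i.e. `z ↦ (t ↦ z (t e ^ (-v)))`. -/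
def logShift (v : ℝ) : LInfty →ₗ[ℝ] LInfty := dilation (Real.exp v) (Real.exp_pos v)

theorem logShift_logShift (v w : ℝ) (z : LInfty) : logShift v (logShift w z) = logShift (v + w) z :=
  Subtype.ext (funext fun t => congrArg z.1 (Subtype.ext
    ((div_div _ _ _).trans (congrArg (t.1 / ·) (Real.exp_add v w).symm))))

theorem dilation_eq_logShift (s : ℝ) (hs : 0 < s) : dilation s hs = logShift (Real.log s) := by
  unfold logShift
  congr 1
  exact (Real.exp_log hs).symm

theorem measurable_scale_exp :
    Measurable fun p : SemiAxis × ℝ => scale (Real.exp p.2) (Real.exp_pos p.2) p.1 :=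
  ((measurable_subtype_coe.comp measurable_fst).div
    (Real.measurable_exp.comp measurable_snd)).subtype_mk

theorem quasiMeasurePreserving_scale_exp (t : SemiAxis) :
    Measure.QuasiMeasurePreserving (fun v : ℝ => scale (Real.exp v) (Real.exp_pos v) t) volume
      lebesgue := by
  have hm : Measurable fun v : ℝ => scale (Real.exp v) (Real.exp_pos v) t :=
    measurable_scale_exp.comp measurable_prodMk_left
  refine ⟨hm, Measure.AbsolutelyContinuous.mk fun A hA h0 => ?_⟩
  have image_null : volume (Subtype.val '' A : Set ℝ) = 0 :=
    (comap_subtype_coe_apply measurableSet_Ioi volume A).symm.trans h0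
  have log_image_null :
      volume ((fun u => Real.log t.1 - Real.log u) '' (Subtype.val '' A)) = 0 := by
    refine addHaar_image_eq_zero_of_differentiableOn_of_addHaar_eq_zero volume ?_ image_null
    rintro _ ⟨u, -, rfl⟩
    exact ((Real.differentiableAt_log u.2.ne').const_sub _).differentiableWithinAt
  rw [Measure.map_apply hm hA]
  refine measure_mono_null (fun v hv => ?_) log_image_null
  refine ⟨_, ⟨_, hv, rfl⟩, ?_⟩
  simp only [scale]
  rw [Real.log_div t.2.ne' (Real.exp_pos v).ne', Real.log_exp, sub_sub_cancel]

theorem intervalIntegrable_logShift (z : LInfty) (t : SemiAxis) (a b : ℝ) :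
    IntervalIntegrable (fun v => (logShift v z).1 t) volume a b := by
  obtain ⟨C, hC⟩ := z.2.2
  have hm := z.2.1.comp_quasiMeasurePreserving (quasiMeasurePreserving_scale_exp t)
  exact (intervalIntegrable_const (c := C)).mono_fun' hm.aestronglyMeasurable.restrict
    (.of_forall fun v => hC _)

/-- The mean `t ↦ a⁻¹ ∫_0^a z (t e ^ (-v)) dv` of `z` over a window of length `a` in the variable
`log t`. -/
def slidingMeanFun (a : ℝ) (z : SemiAxis → ℝ) (t : SemiAxis) : ℝ :=
  a⁻¹ * ∫ v in (0 : ℝ)..a, z (scale (Real.exp v) (Real.exp_pos v) t)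

theorem slidingMeanFun_congr {z w : SemiAxis → ℝ} (h : z =ᵐ[lebesgue] w) (a : ℝ) :
    slidingMeanFun a z = slidingMeanFun a w := by
  ext t
  refine congrArg (a⁻¹ * ·) (intervalIntegral.integral_congr_ae ?_)
  filter_upwards [(quasiMeasurePreserving_scale_exp t).ae_eq_comp h] with v hv _ using hv

theorem abs_slidingMeanFun_le {z : SemiAxis → ℝ} {t : SemiAxis} {a C : ℝ} (hC : 0 ≤ C)
    (h : ∀ v ∈ uIoc 0 a, |z (scale (Real.exp v) (Real.exp_pos v) t)| ≤ C) :
    |slidingMeanFun a z t| ≤ C := by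
  have := intervalIntegral.norm_integral_le_of_norm_le_const (C := C)
    (f := fun v => z (scale (Real.exp v) (Real.exp_pos v) t)) h
  rw [slidingMeanFun, abs_mul, abs_inv]
  exact inv_mul_le_of_le_mul₀ (abs_nonneg a) hC (by simpa [mul_comm] using this)

theorem slidingMeanFun_mem (a : ℝ) (z : LInfty) : slidingMeanFun a z.1 ∈ LInfty := by
  refine ⟨?_, z.2.2.imp fun C hC t => abs_slidingMeanFun_le ((abs_nonneg _).trans (hC t))
    fun v _ => hC _⟩
  obtain ⟨w, hw, hzw⟩ : AEMeasurable z.1 lebesgue := z.2.1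
  rw [slidingMeanFun_congr hzw]
  have hpair : StronglyMeasurable fun p : SemiAxis × ℝ =>
      w (scale (Real.exp p.2) (Real.exp_pos p.2) p.1) :=
    (hw.comp measurable_scale_exp).stronglyMeasurable
  unfold slidingMeanFun intervalIntegral
  exact ((hpair.integral_prod_right'.measurable.sub
    hpair.integral_prod_right'.measurable).const_mul _).aemeasurable

/-- `slidingMeanFun` as an operator on `L_∞(0, ∞)`. -/
def slidingMean (a : ℝ) : LInfty →ₗ[ℝ] LInfty where
  toFun z := ⟨slidingMeanFun a z.1, slidingMeanFun_mem a z⟩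
  map_add' z w := Subtype.ext <| funext fun t =>
    (congrArg (a⁻¹ * ·) (intervalIntegral.integral_add (intervalIntegrable_logShift z t 0 a)
      (intervalIntegrable_logShift w t 0 a))).trans (mul_add _ _ _)
  map_smul' c _ := Subtype.ext <| funext fun _ =>
    (congrArg (a⁻¹ * ·) (intervalIntegral.integral_const_mul c _)).trans (mul_left_comm _ _ _)

theorem slidingMean_apply (a : ℝ) (z : LInfty) (t : SemiAxis) :
    (slidingMean a z).1 t = a⁻¹ * ∫ v in (0 : ℝ)..a, (logShift v z).1 t := rfl

theorem respectsAE_comp_slidingMean (γ : LInfty →ₗ[ℝ] ℝ) (a : ℝ) :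
    RespectsAE (γ ∘ₗ slidingMean a) := fun _ _ h =>
  congrArg γ (Subtype.ext (slidingMeanFun_congr h a))

theorem IsGeneralisedLimit.comp_slidingMean {γ : LInfty →ₗ[ℝ] ℝ} (hγ : IsGeneralisedLimit γ)
    {a : ℝ} (ha : 0 < a) : IsGeneralisedLimit (γ ∘ₗ slidingMean a) where
  nonneg z hz := hγ.nonneg _ fun t => mul_nonneg (inv_nonneg.2 ha.le)
    (intervalIntegral.integral_nonneg ha.le fun v _ => hz _)
  normalised z hz := hγ.normalised _ fun t => by
    change a⁻¹ * ∫ v in (0 : ℝ)..a, z.1 (scale (Real.exp v) (Real.exp_pos v) t) = 1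
    simp [hz, ha.ne']
  vanish z hz := hγ.vanish _ <| by
    refine Metric.nhds_basis_closedBall.tendsto_right_iff.2 fun ε hε => ?_
    obtain ⟨b, hb⟩ := eventually_atTop.1 (Metric.nhds_basis_closedBall.tendsto_right_iff.1 hz ε hε)
    filter_upwards [(tendsto_scale_atTop _ (Real.exp_pos a)).eventually_ge_atTop b] with t ht
    refine mem_closedBall_zero_iff.2 (abs_slidingMeanFun_le hε.le fun v hv =>
      mem_closedBall_zero_iff.1 (hb _ (ht.trans ?_)))
    rw [uIoc_of_le ha.le] at hv
    exact div_le_div_of_nonneg_left t.2.le (Real.exp_pos v) (Real.exp_le_exp.2 hv.2)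

theorem abs_slidingMean_logShift_sub_le {z : LInfty} {C : ℝ} (hC : ∀ t, |z.1 t| ≤ C) {a : ℝ}
    (ha : 0 < a) (v : ℝ) (t : SemiAxis) :
    |(slidingMean a (logShift v z) - slidingMean a z).1 t| ≤ 2 * C * |v| / a := by
  have hint := intervalIntegrable_logShift z t
  have hbound : ∀ b c, |∫ u in b..c, (logShift u z).1 t| ≤ C * |c - b| := fun b c =>
    intervalIntegral.norm_integral_le_of_norm_le_const (C := C)
      (f := fun u => (logShift u z).1 t) fun u _ => hC _
  have shift : ∫ u in (0 : ℝ)..a, (logShift u (logShift v z)).1 t =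
      ∫ u in v..a + v, (logShift u z).1 t := by
    simp only [logShift_logShift]
    rw [intervalIntegral.integral_comp_add_right (fun u => (logShift u z).1 t), zero_add]
  have ends : (∫ u in v..a + v, (logShift u z).1 t) - ∫ u in (0 : ℝ)..a, (logShift u z).1 t =
      (∫ u in a..a + v, (logShift u z).1 t) - ∫ u in (0 : ℝ)..v, (logShift u z).1 t := by
    rw [← intervalIntegral.integral_interval_sub_left (hint 0 (a + v)) (hint 0 v),
      ← intervalIntegral.integral_interval_sub_left (hint 0 (a + v)) (hint 0 a)]
    ring
  change |(slidingMean a (logShift v z)).1 t - (slidingMean a z).1 t| ≤ _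
  rw [slidingMean_apply, slidingMean_apply, ← mul_sub, shift, ends, abs_mul,
    abs_of_pos (inv_pos.2 ha), div_eq_inv_mul]
  refine mul_le_mul_of_nonneg_left ((abs_sub _ _).trans ?_) (inv_nonneg.2 ha.le)
  have h1 := hbound a (a + v)
  have h2 := hbound 0 v
  rw [add_sub_cancel_left] at h1
  rw [sub_zero] at h2
  linarith

theorem nat_smul_slidingMean (n : ℕ) (z : LInfty) :
    (n : ℝ) • slidingMean n z = ∑ i ∈ Finset.range n, logShift i (slidingMean 1 z) := by
  rcases eq_or_ne n 0 with rfl | hn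
  · simp
  have hn' : (n : ℝ) ≠ 0 := Nat.cast_ne_zero.2 hn
  ext t
  have block : ∀ i : ℕ, (logShift i (slidingMean 1 z)).1 t =
      ∫ v in (i : ℝ)..(i + 1 : ℕ), (logShift v z).1 t := fun i => by
    have hshift := intervalIntegral.integral_comp_add_left (a := 0) (b := 1)
      (fun v => (logShift v z).1 t) (i : ℝ)
    simp only [← logShift_logShift, add_zero] at hshift
    rw [Nat.cast_add_one, ← hshift]
    exact (congrArg (· * _) inv_one).trans (one_mul _)
  calc ((n : ℝ) • slidingMean n z).1 t = ∫ v in (0 : ℝ)..n, (logShift v z).1 t :=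
        mul_inv_cancel_left₀ hn' _
    _ = ∑ i ∈ Finset.range n, ∫ v in (i : ℝ)..(i + 1 : ℕ), (logShift v z).1 t := by
        rw [intervalIntegral.sum_integral_adjacent_intervals fun i _ =>
          intervalIntegrable_logShift z t _ _, Nat.cast_zero]
    _ = (∑ i ∈ Finset.range n, logShift i (slidingMean 1 z)).1 t := by
        simp_rw [← block]
        simp [Finset.sum_apply]

/-- Asymptotically, `x` does not drop by more than an arbitrarily small amount while `log t` grows
by at most one. -/
def IsSlowlyIncreasing (x : LInfty) : Prop :=
  ∀ ε : ℝ, 0 < ε → ∀ᶠ t in atTop, ∀ v ∈ Icc (0 : ℝ) 1, (logShift v x).1 t ≤ x.1 t + ε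

namespace IsGeneralisedLimit

variable {γ : LInfty →ₗ[ℝ] ℝ} {x y : LInfty}

theorem comp_logShift (hγ : IsGeneralisedLimit γ) (v : ℝ) :
    IsGeneralisedLimit (γ ∘ₗ logShift v) :=
  hγ.comp_dilation _ _

theorem apply_slidingMean_one_le (hγ : IsGeneralisedLimit γ) (hx : IsSlowlyIncreasing x) :
    γ (slidingMean 1 x) ≤ γ x := by
  refine hγ.le_of_eventually_le_add fun ε hε => ?_
  filter_upwards [hx ε hε] with t ht
  calc (slidingMean 1 x).1 t = ∫ v in (0 : ℝ)..1, (logShift v x).1 t := by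
        rw [slidingMean_apply, inv_one, one_mul]
    _ ≤ ∫ _v in (0 : ℝ)..1, (x.1 t + ε) :=
        intervalIntegral.integral_mono_on zero_le_one (intervalIntegrable_logShift x t 0 1)
          (by simp) ht
    _ = x.1 t + ε := by simp

theorem apply_logShift_one_le (hγ : IsGeneralisedLimit γ) (hx : IsSlowlyIncreasing x) :
    γ (logShift 1 x) ≤ γ (slidingMean 1 x) := by
  refine hγ.le_of_eventually_le_add fun ε hε => ?_
  obtain ⟨b, hb⟩ := eventually_atTop.1 (hx ε hε)
  filter_upwards [(tendsto_scale_atTop _ (Real.exp_pos 1)).eventually_ge_atTop b] with t ht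
  have drop_le : ∀ v ∈ Icc (0 : ℝ) 1, (logShift 1 x).1 t ≤ (logShift v x).1 t + ε := fun v hv => by
    have hscale : b ≤ scale (Real.exp v) (Real.exp_pos v) t := ht.trans
      (div_le_div_of_nonneg_left t.2.le (Real.exp_pos v) (Real.exp_le_exp.2 hv.2))
    have := hb _ hscale (1 - v) ⟨sub_nonneg.2 hv.2, sub_le_self _ hv.1⟩
    rwa [← add_sub_cancel v 1, ← logShift_logShift]
  calc (logShift 1 x).1 t = ∫ _v in (0 : ℝ)..1, (logShift 1 x).1 t := by simp
    _ ≤ ∫ v in (0 : ℝ)..1, ((logShift v x).1 t + ε) :=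
        intervalIntegral.integral_mono_on zero_le_one (by simp)
          ((intervalIntegrable_logShift x t 0 1).add (by simp)) drop_le
    _ = (slidingMean 1 x).1 t + ε := by
        rw [intervalIntegral.integral_add (intervalIntegrable_logShift x t 0 1) (by simp),
          slidingMean_apply, inv_one, one_mul]
        simp

theorem exists_abs_nat_mul_apply_slidingMean_sub_sum_le (hγ : IsGeneralisedLimit γ)
    (hx : IsSlowlyIncreasing x) :
    ∃ C : ℝ, ∀ n : ℕ,
      |n * γ (slidingMean n x) - ∑ i ∈ Finset.range n, γ (logShift i x)| ≤ C := by
  obtain ⟨C, hC⟩ := x.2.2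
  refine ⟨2 * C, fun n => ?_⟩
  have sum_eq : n * γ (slidingMean n x) =
      ∑ i ∈ Finset.range n, γ (logShift i (slidingMean 1 x)) := by
    rw [← smul_eq_mul, ← map_smul, nat_smul_slidingMean, map_sum]
  have upper : ∀ i ∈ Finset.range n, γ (logShift i (slidingMean 1 x)) ≤ γ (logShift i x) :=
    fun i _ => (hγ.comp_logShift i).apply_slidingMean_one_le hx
  have lower : ∀ i ∈ Finset.range n,
      γ (logShift (i + 1 : ℕ) x) ≤ γ (logShift i (slidingMean 1 x)) := fun i _ => by
    rw [Nat.cast_succ, ← logShift_logShift]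
    exact (hγ.comp_logShift i).apply_logShift_one_le hx
  have telescope := Finset.sum_range_sub (fun i : ℕ => γ (logShift i x)) n
  rw [Finset.sum_sub_distrib] at telescope
  have first := abs_le.1 ((hγ.comp_logShift (0 : ℕ)).abs_apply_le hC)
  have last := abs_le.1 ((hγ.comp_logShift n).abs_apply_le hC)
  simp only [LinearMap.comp_apply] at first last
  rw [sum_eq, abs_le]
  constructor <;> linarith [Finset.sum_le_sum upper, Finset.sum_le_sum lower]

theorem tendsto_apply_slidingMean_sub (hγ : IsGeneralisedLimit γ) (hx : IsSlowlyIncreasing x)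
    (hy : IsSlowlyIncreasing y) (hinv : ∀ v, γ (logShift v (x - y)) = γ (x - y)) :
    Tendsto (fun n : ℕ => γ (slidingMean n (x - y))) atTop (𝓝 (γ (x - y))) := by
  obtain ⟨C, hC⟩ := hγ.exists_abs_nat_mul_apply_slidingMean_sub_sum_le hx
  obtain ⟨D, hD⟩ := hγ.exists_abs_nat_mul_apply_slidingMean_sub_sum_le hy
  have bound : ∀ᶠ n : ℕ in atTop, ‖γ (slidingMean n (x - y)) - γ (x - y)‖ ≤ (C + D) / n := by
    filter_upwards [eventually_gt_atTop 0] with n hn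
    have sum_eq : ∑ i ∈ Finset.range n, γ (logShift i x) -
        ∑ i ∈ Finset.range n, γ (logShift i y) = n * γ (x - y) := by
      rw [← Finset.sum_sub_distrib]
      simp_rw [← map_sub, hinv]
      simp [-map_sub]
    rw [le_div_iff₀' (Nat.cast_pos.2 hn)]
    calc n * ‖γ (slidingMean n (x - y)) - γ (x - y)‖
        = |(n * γ (slidingMean n x) - ∑ i ∈ Finset.range n, γ (logShift i x)) -
            (n * γ (slidingMean n y) - ∑ i ∈ Finset.range n, γ (logShift i y))| := by
          rw [sub_sub_sub_comm, sum_eq, map_sub (slidingMean n), map_sub γ (slidingMean _ _),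
            ← mul_sub, ← mul_sub, abs_mul, Nat.abs_cast, Real.norm_eq_abs]
      _ ≤ C + D := (abs_sub _ _).trans (add_le_add (hC n) (hD n))
  exact tendsto_iff_norm_sub_tendsto_zero.2 (squeeze_zero' (.of_forall fun _ => norm_nonneg _)
    bound (tendsto_const_nhds.div_atTop tendsto_natCast_atTop_atTop))

theorem tendsto_apply_slidingMean_dilation_sub (hγ : IsGeneralisedLimit γ) (s : ℝ) (hs : 0 < s)
    (z : LInfty) :
    Tendsto (fun n : ℕ => γ (slidingMean n (dilation s hs z)) - γ (slidingMean n z)) atTop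
      (𝓝 0) := by
  obtain ⟨C, hC⟩ := z.2.2
  refine squeeze_zero_norm' ?_ ((tendsto_const_nhds (x := 2 * C * |Real.log s|)).div_atTop
    tendsto_natCast_atTop_atTop)
  filter_upwards [eventually_gt_atTop 0] with n hn
  rw [dilation_eq_logShift, ← map_sub]
  exact hγ.abs_apply_le (abs_slidingMean_logShift_sub_le hC (Nat.cast_pos.2 hn) _)

theorem exists_isDilationInvariant (hγ : IsGeneralisedLimit γ) :
    ∃ ω : LInfty →ₗ[ℝ] ℝ, IsGeneralisedLimit ω ∧ IsDilationInvariant ω ∧ RespectsAE ω ∧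
      ∀ x y, IsSlowlyIncreasing x → IsSlowlyIncreasing y →
        (∀ s hs, γ (dilation s hs (x - y)) = γ (x - y)) → ω (x - y) = γ (x - y) := by
  have succ_tendsto : Tendsto (· + 1) (hyperfilter ℕ : Filter ℕ) atTop :=
    (tendsto_add_atTop_nat 1).mono_left (Nat.cofinite_eq_atTop ▸ hyperfilter_le_cofinite)
  obtain ⟨ω, hω, hlim⟩ := exists_tendsto_ultrafilter (hyperfilter ℕ)
    (φ := fun n => γ ∘ₗ slidingMean (n + 1 : ℕ)) fun n =>
      hγ.comp_slidingMean (Nat.cast_pos.2 n.succ_pos)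
  refine ⟨ω, hω, fun s hs z => ?_, fun z w hzw => ?_, fun x y hx hy hinv => ?_⟩
  · exact sub_eq_zero.1 (tendsto_nhds_unique ((hlim _).sub (hlim z))
      ((hγ.tendsto_apply_slidingMean_dilation_sub s hs z).comp succ_tendsto))
  · exact tendsto_nhds_unique (hlim z) ((hlim w).congr fun n =>
      respectsAE_comp_slidingMean γ _ w z hzw.symm)
  · exact tendsto_nhds_unique (hlim _)
      ((hγ.tendsto_apply_slidingMean_sub hx hy fun v => hinv _ _).comp succ_tendsto)

end IsGeneralisedLimit

/-! ### Logarithmic means of nonnegative functions -/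

theorem tendsto_log_semiAxis_atTop :
    Tendsto (fun t : SemiAxis => Real.log t.1) atTop atTop :=
  tendsto_atTop.2 fun b => (eventually_ge_atTop ⟨Real.exp b, Real.exp_pos b⟩).mono fun t ht =>
    (Real.le_log_iff_exp_le t.2).2 ht

/-- The nonnegative function `h` on `(0, ∞)` has a bounded logarithmic mean `cesaro h`, including
near the singular point `t = 1` of the factor `1 / log t`. -/
structure HasBoundedLogMean (h : ℝ → ℝ) : Prop where
  nonneg : ∀ t, 0 < t → 0 ≤ h t
  intervalIntegrable : ∀ a b, 0 < a → 0 < b → IntervalIntegrable (fun s => h s / s) volume a b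
  exists_abs_integral_le : ∃ C, ∀ t, 0 < t → |∫ s in (1 : ℝ)..t, h s / s| ≤ C * |Real.log t|

namespace HasBoundedLogMean

variable {h g : ℝ → ℝ}

theorem monotone_integral (hh : HasBoundedLogMean h) :
    Monotone fun t : SemiAxis => ∫ s in (1 : ℝ)..t, h s / s := fun a b hab => by
  have nonneg : 0 ≤ ∫ s in (a : ℝ)..b, h s / s := intervalIntegral.integral_nonneg hab fun s hs =>
    div_nonneg (hh.nonneg s (a.2.trans_le hs.1)) (a.2.le.trans hs.1)
  change (∫ s in (1 : ℝ)..a, h s / s) ≤ ∫ s in (1 : ℝ)..b, h s / s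
  rw [← intervalIntegral.integral_add_adjacent_intervals
    (hh.intervalIntegrable 1 a zero_lt_one a.2) (hh.intervalIntegrable a b a.2 b.2)]
  exact le_add_of_nonneg_right nonneg

theorem cesaro_mem_LInfty (hh : HasBoundedLogMean h) : cesaro h ∈ LInfty := by
  refine ⟨((measurable_const.div (Real.measurable_log.comp measurable_subtype_coe)).mul
    hh.monotone_integral.measurable).aemeasurable, ?_⟩
  obtain ⟨C, hC⟩ := hh.exists_abs_integral_le
  refine ⟨|C|, fun t => ?_⟩
  rw [cesaro, abs_mul, abs_div, abs_one, one_div]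
  exact inv_mul_le_of_le_mul₀ (abs_nonneg _) (abs_nonneg C)
    ((hC t t.2).trans ((mul_le_mul_of_nonneg_right (le_abs_self C) (abs_nonneg _)).trans_eq
      (mul_comm _ _)))

/-- The logarithmic mean `M h`, as an element of `L_∞(0, ∞)`. -/
def logMean (hh : HasBoundedLogMean h) : LInfty := ⟨cesaro h, hh.cesaro_mem_LInfty⟩

theorem logMean_mul_log (hh : HasBoundedLogMean h) {t : SemiAxis} (ht : Real.log t ≠ 0) :
    hh.logMean.1 t * Real.log t = ∫ s in (1 : ℝ)..t, h s / s := by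
  change 1 / Real.log t * _ * _ = _
  field_simp

theorem isSlowlyIncreasing_logMean (hh : HasBoundedLogMean h) : IsSlowlyIncreasing hh.logMean := by
  intro ε hε
  obtain ⟨C, hC⟩ := hh.logMean.2.2
  filter_upwards [tendsto_log_semiAxis_atTop.eventually_ge_atTop (2 + |C| / ε)] with t ht v hv
  set s := scale (Real.exp v) (Real.exp_pos v) t
  have log_s : Real.log s = Real.log t - v :=
    (Real.log_div t.2.ne' (Real.exp_pos v).ne').trans (by rw [Real.log_exp])
  have integral_le : hh.logMean.1 s * Real.log s ≤ hh.logMean.1 t * Real.log t := by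
    have : 0 ≤ |C| / ε := by positivity
    rw [hh.logMean_mul_log (by linarith [hv.2]), hh.logMean_mul_log (by linarith)]
    exact hh.monotone_integral (div_le_self t.2.le (Real.one_le_exp hv.1))
  have log_s_ge : 1 + |C| / ε ≤ Real.log s := by linarith [hv.2]
  have le_eps : hh.logMean.1 t * v ≤ ε * Real.log s := calc
    hh.logMean.1 t * v ≤ |C| * 1 := mul_le_mul
      ((le_abs_self _).trans ((hC t).trans (le_abs_self C))) hv.2 hv.1 (abs_nonneg C)
    _ = ε * (|C| / ε) := by field_simp
    _ ≤ ε * Real.log s := by gcongr; linarith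
  refine le_of_mul_le_mul_right ?_ ((by positivity : 0 < 1 + |C| / ε).trans_le log_s_ge)
  calc hh.logMean.1 s * Real.log s ≤ hh.logMean.1 t * Real.log t := integral_le
    _ = hh.logMean.1 t * Real.log s + hh.logMean.1 t * v := by rw [log_s]; ring
    _ ≤ (hh.logMean.1 t + ε) * Real.log s := by rw [add_mul]; gcongr

theorem integral_of_eq_mul_comp_mul (hh : HasBoundedLogMean h) {c : ℝ} (hc : 0 < c)
    (hgh : ∀ t, 0 < t → g t = c * h (c * t)) {t : ℝ} (ht : 0 < t) :
    ∫ s in (1 : ℝ)..t, g s / s =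
      c * ((∫ s in (1 : ℝ)..c * t, h s / s) - ∫ s in (1 : ℝ)..c, h s / s) := by
  have hint := fun b hb => hh.intervalIntegrable 1 b zero_lt_one hb
  rw [intervalIntegral.integral_interval_sub_left (hint _ (mul_pos hc ht)) (hint c hc)]
  calc ∫ s in (1 : ℝ)..t, g s / s = ∫ s in (1 : ℝ)..t, c * (c * (h (c * s) / (c * s))) := by
        refine intervalIntegral.integral_congr fun s hs => ?_
        have hs' : 0 < s := (lt_min zero_lt_one ht).trans_le hs.1
        simp only [hgh s hs']
        field_simp
    _ = c * ∫ s in c..c * t, h s / s := by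
        rw [intervalIntegral.integral_const_mul, intervalIntegral.integral_const_mul,
          intervalIntegral.mul_integral_comp_mul_left (f := fun u => h u / u), mul_one]

theorem apply_logMean_of_eq_mul_comp_mul (hg : HasBoundedLogMean g) (hh : HasBoundedLogMean h)
    {c : ℝ} (hc : 0 < c) (hgh : ∀ t, 0 < t → g t = c * h (c * t)) {γ : LInfty →ₗ[ℝ] ℝ}
    (hγ : IsGeneralisedLimit γ) :
    γ hg.logMean = c * γ (dilation c⁻¹ (inv_pos.2 hc) hh.logMean) := by
  rw [← smul_eq_mul, ← map_smul, ← sub_eq_zero, ← map_sub]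
  refine hγ.vanish _ ?_
  obtain ⟨C, hC⟩ := hh.logMean.2.2
  set G := ∫ s in (1 : ℝ)..c, h s / s
  refine squeeze_zero_norm' (a := fun t : SemiAxis => c * (C * |Real.log c| + |G|) / Real.log t) ?_
    (tendsto_const_nhds.div_atTop tendsto_log_semiAxis_atTop)
  filter_upwards [tendsto_log_semiAxis_atTop.eventually_gt_atTop (max 0 (-Real.log c))] with t ht
  set s := scale c⁻¹ (inv_pos.2 hc) t
  have log_t : 0 < Real.log t := (le_max_left _ _).trans_lt ht
  have hs : (s : ℝ) = c * t := (div_inv_eq_mul _ _).trans (mul_comm _ _)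
  have log_s : Real.log s = Real.log c + Real.log t := by rw [hs, Real.log_mul hc.ne' t.2.ne']
  have log_s_pos : 0 < Real.log s := by linarith [(le_max_right _ _).trans_lt ht]
  have key : hg.logMean.1 t * Real.log t = c * (hh.logMean.1 s * Real.log s - G) := by
    rw [hg.logMean_mul_log log_t.ne', hh.logMean_mul_log log_s_pos.ne', hs,
      hh.integral_of_eq_mul_comp_mul hc hgh t.2]
  have difference : (hg.logMean.1 t - c * hh.logMean.1 s) * Real.log t =
      c * (hh.logMean.1 s * Real.log c - G) := by
    rw [sub_mul, key, log_s]
    ring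
  change |hg.logMean.1 t - c * hh.logMean.1 s| ≤ _
  rw [le_div_iff₀ log_t, ← abs_of_pos log_t, ← abs_mul, difference, abs_mul, abs_of_pos hc]
  refine mul_le_mul_of_nonneg_left ((abs_sub _ _).trans ?_) hc.le
  rw [abs_mul]
  gcongr
  exact hC s

end HasBoundedLogMean

section

variable {h : ℝ → ℝ} {K : ℝ}

theorem norm_div_le_of_le_mul_pow (h0 : ∀ t, 0 < t → 0 ≤ h t) (hK : ∀ t, 0 < t → h t ≤ K * t ^ 3)
    {s : ℝ} (hs : 0 < s) : ‖h s / s‖ ≤ K * s ^ 2 := by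
  rw [Real.norm_of_nonneg (div_nonneg (h0 s hs) hs.le), div_le_iff₀ hs]
  exact (hK s hs).trans_eq (by ring)

theorem abs_integral_div_le_mul_abs_log (h0 : ∀ t, 0 < t → 0 ≤ h t)
    (hK : ∀ t, 0 < t → h t ≤ K * t ^ 3) {b t : ℝ} (hb : 1 ≤ b) (ht : 0 < t) (htb : t ≤ b) :
    |∫ s in (1 : ℝ)..t, h s / s| ≤ K * b ^ 3 * |Real.log t| := by
  have K_nonneg : 0 ≤ K := by simpa using (h0 1 one_pos).trans (hK 1 one_pos)
  have le_inv : ∀ s ∈ uIoc 1 t, ‖h s / s‖ ≤ K * b ^ 3 * s⁻¹ := fun s hs => by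
    have hs0 : 0 < s := (lt_min one_pos ht).trans hs.1
    calc ‖h s / s‖ ≤ K * s ^ 2 := norm_div_le_of_le_mul_pow h0 hK hs0
      _ = K * s ^ 3 * s⁻¹ := by field_simp
      _ ≤ K * b ^ 3 * s⁻¹ := by
          gcongr
          exact hs.2.trans (max_le hb htb)
  have hint : IntervalIntegrable (fun s => K * b ^ 3 * s⁻¹) volume 1 t :=
    (intervalIntegral.intervalIntegrable_inv (fun s hs => ((lt_min one_pos ht).trans_le hs.1).ne')
      continuousOn_id).const_mul _
  calc |∫ s in (1 : ℝ)..t, h s / s| ≤ |∫ s in (1 : ℝ)..t, K * b ^ 3 * s⁻¹| :=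
        intervalIntegral.norm_integral_le_abs_of_norm_le
          ((ae_restrict_mem measurableSet_uIoc).mono le_inv) hint
    _ = K * b ^ 3 * |Real.log t| := by
        rw [intervalIntegral.integral_const_mul, integral_inv_of_pos one_pos ht, div_one, abs_mul,
          abs_of_nonneg (by positivity : 0 ≤ K * b ^ 3)]

theorem abs_integral_div_le_of_lintegral_le (hm : Measurable h) (h0 : ∀ t, 0 < t → 0 ≤ h t)
    {t M : ℝ} (ht : 1 ≤ t) (hM : 0 ≤ M)
    (hle : ∫⁻ s in Ioc 1 t, ENNReal.ofReal (h s / s) ≤ ENNReal.ofReal M) :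
    |∫ s in (1 : ℝ)..t, h s / s| ≤ M := by
  have ae_nonneg : 0 ≤ᵐ[volume.restrict (Ioc 1 t)] fun s => h s / s := by
    filter_upwards [ae_restrict_mem measurableSet_Ioc] with s hs
    exact div_nonneg (h0 s (one_pos.trans hs.1)) (zero_le_one.trans hs.1.le)
  rw [intervalIntegral.integral_of_le ht, abs_of_nonneg (integral_nonneg_of_ae ae_nonneg),
    integral_eq_lintegral_of_nonneg_ae ae_nonneg (hm.div measurable_id).aestronglyMeasurable]
  exact ENNReal.toReal_le_of_le_ofReal hM hle

theorem HasBoundedLogMean.of_le_mul_pow (hm : Measurable h) (h0 : ∀ t, 0 < t → 0 ≤ h t)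
    (hK : ∀ t, 0 < t → h t ≤ K * t ^ 3) {D : ℝ} (hD : ∀ T, Real.exp 1 ≤ T →
      ∫⁻ t in Ioc 1 T, ENNReal.ofReal (h t / t) ≤ ENNReal.ofReal (D * Real.log T)) :
    HasBoundedLogMean h where
  nonneg := h0
  intervalIntegrable a b ha hb := by
    refine (by fun_prop : Continuous fun s : ℝ => K * s ^ 2).intervalIntegrable a b |>.mono_fun'
      (hm.div measurable_id).aestronglyMeasurable ?_
    filter_upwards [ae_restrict_mem measurableSet_uIoc] with s hs
    exact norm_div_le_of_le_mul_pow h0 hK ((lt_min ha hb).trans hs.1)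
  exists_abs_integral_le := by
    refine ⟨max (K * Real.exp 1 ^ 3) |D|, fun t ht => ?_⟩
    have one_le_exp := Real.one_le_exp zero_le_one
    rcases le_total t (Real.exp 1) with hte | hte
    · refine (abs_integral_div_le_mul_abs_log h0 hK one_le_exp ht hte).trans ?_
      gcongr
      exact le_max_left _ _
    · refine (abs_integral_div_le_of_lintegral_le hm h0 (one_le_exp.trans hte) (by positivity)
        ((hD t hte).trans (ENNReal.ofReal_le_ofReal (le_abs_self _)))).trans ?_
      rw [abs_mul]
      gcongr
      exact le_max_right _ _

end

/-! ### The heat kernel function of the positive part of an operator -/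

variable {A : H →L[ℂ] H} {q : ℝ}

theorem coe_realPart_real_smul (c : ℝ) (A : H →L[ℂ] H) :
    (ℜ ((c : ℂ) • A) : H →L[ℂ] H) = c • (ℜ A : H →L[ℂ] H) := by
  rw [Complex.coe_smul, map_smul, selfAdjoint.val_smul]

theorem posPart_realPart_mem (hA : A ∈ N) : (ℜ A : H →L[ℂ] H)⁺ ∈ N := by
  rw [CFC.posPart_def, cfcₙ_eq_cfc]
  exact cfc_mem (realPart_mem hA) _

theorem heatOp_posPart_realPart (hq : 0 < q) (A : H →L[ℂ] H) {t : ℝ} (ht : 0 ≤ t) :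
    heatOp q (ℜ A : H →L[ℂ] H)⁺ t = cfc (expNegPow q) (ℜ ((t : ℂ) • A) : H →L[ℂ] H) := by
  rw [heatOp, ← CFC.posPart_smul_of_nonneg ht, ← coe_realPart_real_smul,
    cfc_posPart (continuous_expNegPow hq) (ℜ _).2]
  congr 1
  ext x
  rcases le_total 0 x with hx | hx
  · rw [posPart_eq_self.2 hx]
  · rw [posPart_eq_zero.2 hx, expNegPow_of_nonpos q hx, expNegPow_of_nonpos q le_rfl]

theorem heatFun_smul (τ : (H →L[ℂ] H) → ℝ≥0∞) (q : ℝ) (B : H →L[ℂ] H) {c : ℝ} (hc : c ≠ 0)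
    (t : ℝ) : heatFun τ q (c • B) t = c * heatFun τ q B (c * t) := by
  rw [heatFun, heatFun, heatOp, heatOp, smul_smul, mul_comm t c, one_div_mul_eq_div,
    one_div_mul_eq_div, ← mul_div_assoc, mul_div_mul_left _ _ hc]

namespace IsNormalTrace

theorem exists_hasLogPrimitive_singularValue (hτ : IsNormalTrace N τ)
    (hA : A ∈ dixmierIdeal N τ) : ∃ C, HasLogPrimitive (singularValue N τ A) C := by
  obtain ⟨-, C, hC⟩ := hA
  refine ⟨C, hτ.antitone_singularValue A, singularValue_nonneg N τ A, fun t ht => ?_⟩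
  have h := hC t ht
  rwa [one_div, inv_mul_le_iff₀ (Real.log_pos (by linarith)), mul_comm] at h

theorem heatOp_le_lintegral (hτ : IsNormalTrace N τ) (hq : 0 < q) (hA : A ∈ N) {t : ℝ}
    (ht : 0 ≤ t) :
    τ (heatOp q (ℜ A : H →L[ℂ] H)⁺ t) ≤
      2 * ∫⁻ s in Ioi (0 : ℝ), ENNReal.ofReal (expNegPow q (t * (8 * singularValue N τ A s))) := by
  have hle := hτ.cfc_realPart_le_lintegral (smul_mem hA t) (continuous_expNegPow hq)
    (monotone_expNegPow hq) fun x => expNegPow_of_nonpos q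
  simp only [singularValue_smul, Complex.norm_real, Real.norm_of_nonneg ht, mul_left_comm (8 : ℝ)]
    at hle
  rwa [heatOp_posPart_realPart hq A ht]

theorem exists_heatOp_le (hτ : IsNormalTrace N τ) (hq : 0 < q) (hA : A ∈ dixmierIdeal N τ) :
    ∃ K : ℝ, 0 ≤ K ∧ ∀ t, 0 ≤ t →
      τ (heatOp q (ℜ A : H →L[ℂ] H)⁺ t) ≤ ENNReal.ofReal (K * t ^ 4) := by
  obtain ⟨K, hK⟩ := exists_isCutoff_expNegPow hq
  obtain ⟨C, hC⟩ := hτ.exists_hasLogPrimitive_singularValue hA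
  set I := ∫⁻ s in Ioi (0 : ℝ), ENNReal.ofReal ((8 * singularValue N τ A s) ^ 4)
  have hI : I ≠ ∞ := (hC.const_mul (by norm_num : (0 : ℝ) ≤ 8)).lintegral_pow_four_ne_top
  have := hK.const_nonneg
  refine ⟨2 * I.toReal * K, by positivity, fun t ht => (hτ.heatOp_le_lintegral hq hA.1 ht).trans ?_⟩
  calc 2 * ∫⁻ s in Ioi (0 : ℝ), ENNReal.ofReal (expNegPow q (t * (8 * singularValue N τ A s)))
      ≤ 2 * (ENNReal.ofReal (K * t ^ 4) * I) := by gcongr; exact hK.lintegral_comp_mul_le _ _ _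
    _ = ENNReal.ofReal (2 * I.toReal * K * t ^ 4) := by
        rw [mul_assoc (2 * I.toReal), ENNReal.ofReal_mul (p := 2 * I.toReal) (by positivity),
          ENNReal.ofReal_mul (p := 2) zero_le_two, ENNReal.ofReal_toReal hI, ENNReal.ofReal_ofNat]
        ring

theorem heatOp_lt_top (hτ : IsNormalTrace N τ) (hq : 0 < q) (hA : A ∈ dixmierIdeal N τ) {t : ℝ}
    (ht : 0 ≤ t) : τ (heatOp q (ℜ A : H →L[ℂ] H)⁺ t) < ∞ :=
  let ⟨_, _, hK⟩ := hτ.exists_heatOp_le hq hA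
  (hK t ht).trans_lt ENNReal.ofReal_lt_top

theorem exists_lintegral_heatOp_le (hτ : IsNormalTrace N τ) (hq : 0 < q)
    (hA : A ∈ dixmierIdeal N τ) :
    ∃ D : ℝ, ∀ T, Real.exp 1 ≤ T →
      ∫⁻ t in Ioc 1 T, τ (heatOp q (ℜ A : H →L[ℂ] H)⁺ t) * ENNReal.ofReal (t ^ 2)⁻¹ ≤
        ENNReal.ofReal (D * Real.log T) := by
  obtain ⟨K, hK⟩ := exists_isCutoff_expNegPow hq
  obtain ⟨C, hC⟩ := hτ.exists_hasLogPrimitive_singularValue hA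
  obtain ⟨D, hD⟩ := hK.exists_lintegral_lintegral_le (hC.const_mul (by norm_num : (0 : ℝ) ≤ 8))
  refine ⟨2 * D, fun T hT => ?_⟩
  rw [mul_assoc, ENNReal.ofReal_mul zero_le_two, ENNReal.ofReal_ofNat]
  refine le_trans ?_ (mul_le_mul_right (hD T hT) 2)
  rw [← lintegral_const_mul' _ _ ENNReal.ofNat_ne_top]
  refine setLIntegral_mono' measurableSet_Ioc fun t ht => ?_
  rw [← mul_assoc]
  gcongr
  exact hτ.heatOp_le_lintegral hq hA.1 (zero_le_one.trans ht.1.le)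

theorem monotone_heatOp (hτ : IsNormalTrace N τ) (hq : 0 < q) {B : H →L[ℂ] H} (hB : B ∈ N)
    (hB0 : 0 ≤ B) : Monotone fun t => τ (heatOp q B t) := by
  intro s t hst
  have hF := continuous_expNegPow hq
  have heatOp_eq : ∀ r, heatOp q B r = cfc (fun x => expNegPow q (r * x)) B := fun r =>
    (cfc_comp_const_mul r _ B hF.continuousOn).symm
  refine hτ.mono (cfc_mem (real_smul_mem hB s) _) (cfc_mem (real_smul_mem hB t) _)
    (cfc_nonneg fun x _ => expNegPow_nonneg q x) ?_
  rw [heatOp_eq, heatOp_eq]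
  exact cfc_mono (fun x hx => monotone_expNegPow hq
    (mul_le_mul_of_nonneg_right hst (spectrum_nonneg_of_nonneg hB0 hx)))

theorem hasBoundedLogMean_heatFun (hτ : IsNormalTrace N τ) (hq : 0 < q)
    (hA : A ∈ dixmierIdeal N τ) : HasBoundedLogMean (heatFun τ q (ℜ A : H →L[ℂ] H)⁺) := by
  obtain ⟨K, K_nonneg, hK⟩ := hτ.exists_heatOp_le hq hA
  obtain ⟨D, hD⟩ := hτ.exists_lintegral_heatOp_le hq hA
  have hm := (hτ.monotone_heatOp hq (posPart_realPart_mem hA.1) (CFC.posPart_nonneg _)).measurable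
  refine .of_le_mul_pow (K := K) (D := D)
    ((measurable_const.div measurable_id).mul hm.ennreal_toReal)
    (fun t ht => by unfold heatFun; positivity) (fun t ht => ?_) fun T hT => ?_
  · rw [heatFun, one_div, inv_mul_le_iff₀ ht]
    refine (ENNReal.toReal_le_of_le_ofReal (by positivity) (hK t ht.le)).trans_eq ?_
    ring
  · refine (setLIntegral_congr_fun measurableSet_Ioc fun t ht => ?_).trans_le (hD T hT)
    have ht0 : 0 < t := zero_lt_one.trans ht.1
    conv_rhs => rw [← ENNReal.ofReal_toReal (hτ.heatOp_lt_top hq hA ht0.le).ne,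
      ← ENNReal.ofReal_mul ENNReal.toReal_nonneg]
    rw [heatFun]
    congr 1
    field_simp

end IsNormalTrace

/-! ### The real part of `ξ_γ` -/

variable {γ : LInfty →ₗ[ℝ] ℝ}

theorem HasBoundedLogMean.xiPos_eq {B : H →L[ℂ] H} (h : HasBoundedLogMean (heatFun τ q B))
    (γ : LInfty →ₗ[ℝ] ℝ) : xiPos τ q γ B = γ h.logMean :=
  dif_pos h.cesaro_mem_LInfty

theorem im_xi (τ : (H →L[ℂ] H) → ℝ≥0∞) (q : ℝ) (γ : LInfty →ₗ[ℝ] ℝ) (A : H →L[ℂ] H) :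
    (xi τ q γ A).im = (xi τ q γ (-Complex.I • A)).re := by
  simp [xi]

namespace IsNormalTrace

theorem hasBoundedLogMean_heatFun_negPart (hτ : IsNormalTrace N τ) (hq : 0 < q)
    (hA : A ∈ dixmierIdeal N τ) : HasBoundedLogMean (heatFun τ q (ℜ A : H →L[ℂ] H)⁻) := by
  have h := hτ.hasBoundedLogMean_heatFun hq (smul_mem_dixmierIdeal hA (-1 : ℝ))
  rwa [coe_realPart_real_smul, neg_one_smul, CFC.posPart_neg] at h

/-- The function in `L_∞(0, ∞)` whose value under `γ` is the real part of `ξ_γ(A)`. -/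
def reLogMean (hτ : IsNormalTrace N τ) (hq : 0 < q) (hA : A ∈ dixmierIdeal N τ) : LInfty :=
  (hτ.hasBoundedLogMean_heatFun hq hA).logMean -
    (hτ.hasBoundedLogMean_heatFun_negPart hq hA).logMean

theorem re_xi (hτ : IsNormalTrace N τ) (hq : 0 < q) (hA : A ∈ dixmierIdeal N τ)
    (γ : LInfty →ₗ[ℝ] ℝ) : (xi τ q γ A).re = γ (hτ.reLogMean hq hA) := by
  rw [reLogMean, map_sub, ← HasBoundedLogMean.xiPos_eq, ← HasBoundedLogMean.xiPos_eq]
  simp [xi]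

theorem apply_reLogMean_smul (hτ : IsNormalTrace N τ) (hq : 0 < q) (hA : A ∈ dixmierIdeal N τ)
    (hγ : IsGeneralisedLimit γ) {c : ℝ} (hc : 0 < c) :
    γ (hτ.reLogMean hq (smul_mem_dixmierIdeal hA c)) =
      c * γ (dilation c⁻¹ (inv_pos.2 hc) (hτ.reLogMean hq hA)) := by
  simp only [reLogMean, map_sub, mul_sub]
  congr 1 <;> refine HasBoundedLogMean.apply_logMean_of_eq_mul_comp_mul _ _ hc (fun t _ => ?_) hγ
  · rw [coe_realPart_real_smul, CFC.posPart_smul_of_nonneg hc.le, heatFun_smul τ q _ hc.ne']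
  · rw [coe_realPart_real_smul, CFC.negPart_smul_of_nonneg hc.le, heatFun_smul τ q _ hc.ne']

theorem apply_dilation_reLogMean (hτ : IsNormalTrace N τ) (hq : 0 < q)
    (hA : A ∈ dixmierIdeal N τ) (hγ : IsGeneralisedLimit γ)
    (hhom : ∀ c : ℝ, 0 < c → xi τ q γ ((c : ℂ) • A) = c * xi τ q γ A) (s : ℝ) (hs : 0 < s) :
    γ (dilation s hs (hτ.reLogMean hq hA)) = γ (hτ.reLogMean hq hA) := by
  obtain ⟨c, rfl⟩ : ∃ c, s = c⁻¹ := ⟨s⁻¹, (inv_inv s).symm⟩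
  have hc := inv_pos.1 hs
  refine mul_left_cancel₀ hc.ne' ?_
  rw [← hτ.apply_reLogMean_smul hq hA hγ hc, ← hτ.re_xi, ← hτ.re_xi, hhom c hc,
    Complex.re_ofReal_mul]

end IsNormalTrace

end HeatKernel

end

theorem mainTheorem7_general {H : Type*} [NormedAddCommGroup H] [InnerProductSpace ℂ H]
    [CompleteSpace H] (N : VonNeumannAlgebra H) (τ : (H →L[ℂ] H) → ℝ≥0∞)
    (hτ : HeatKernel.IsNormalTrace N τ) (q : ℝ) (hq : 0 < q) :
    (∀ A ∈ HeatKernel.dixmierIdeal N τ, 0 ≤ A →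
      (∀ t : ℝ, 0 < t → τ (HeatKernel.heatOp q A t) < ∞) ∧
        HeatKernel.cesaro (HeatKernel.heatFun τ q A) ∈ HeatKernel.LInfty) ∧
    ∀ γ : HeatKernel.LInfty →ₗ[ℝ] ℝ, HeatKernel.IsGeneralisedLimit γ →
      (∀ c : ℝ, 0 < c → ∀ A ∈ HeatKernel.dixmierIdeal N τ,
        HeatKernel.xi τ q γ ((c : ℂ) • A) = c * HeatKernel.xi τ q γ A) →
      ∃ ω : HeatKernel.LInfty →ₗ[ℝ] ℝ, HeatKernel.IsGeneralisedLimit ω ∧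
        HeatKernel.IsDilationInvariant ω ∧ HeatKernel.RespectsAE ω ∧
        ∀ A ∈ HeatKernel.dixmierIdeal N τ, HeatKernel.xi τ q γ A = HeatKernel.xi τ q ω A := by
  refine ⟨fun A hA hA0 => ?_, fun γ hγ hhom => ?_⟩
  · have realPart_posPart : (ℜ A : H →L[ℂ] H)⁺ = A := by
      rw [(IsSelfAdjoint.of_nonneg hA0).coe_realPart, (CFC.posPart_eq_self A).2 hA0]
    exact ⟨fun t ht => by simpa only [realPart_posPart] using hτ.heatOp_lt_top hq hA ht.le,
      realPart_posPart ▸ (hτ.hasBoundedLogMean_heatFun hq hA).cesaro_mem_LInfty⟩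
  · obtain ⟨ω, hω, hdil, hae, hωγ⟩ := hγ.exists_isDilationInvariant
    have re_eq : ∀ A ∈ HeatKernel.dixmierIdeal N τ,
        (HeatKernel.xi τ q γ A).re = (HeatKernel.xi τ q ω A).re := fun A hA => by
      rw [hτ.re_xi hq hA, hτ.re_xi hq hA]
      exact (hωγ _ _ (HeatKernel.HasBoundedLogMean.isSlowlyIncreasing_logMean _)
        (HeatKernel.HasBoundedLogMean.isSlowlyIncreasing_logMean _)
        (hτ.apply_dilation_reLogMean hq hA hγ fun c hc => hhom c hc A hA)).symm
    refine ⟨ω, hω, hdil, hae, fun A hA => Complex.ext (re_eq A hA) ?_⟩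
    rw [HeatKernel.im_xi, HeatKernel.im_xi]
    exact re_eq _ (HeatKernel.smul_mem_dixmierIdeal hA _)

theorem mainTheorem7 {H : Type*} [NormedAddCommGroup H] [InnerProductSpace ℂ H] [CompleteSpace H]
    (N : VonNeumannAlgebra H) (τ : (H →L[ℂ] H) → ℝ≥0∞)
    (hτ : HeatKernel.IsFaithfulNormalSemifiniteTrace N τ) (q : ℝ) (hq : 0 < q) :
    (∀ A ∈ HeatKernel.dixmierIdeal N τ, 0 ≤ A →
      (∀ t : ℝ, 0 < t → τ (HeatKernel.heatOp q A t) < ∞) ∧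
        HeatKernel.cesaro (HeatKernel.heatFun τ q A) ∈ HeatKernel.LInfty) ∧
    ∀ γ : HeatKernel.LInfty →ₗ[ℝ] ℝ, HeatKernel.IsGeneralisedLimit γ →
      HeatKernel.IsLinearFunctionalOn (HeatKernel.dixmierIdeal N τ) (HeatKernel.xi τ q γ) →
      ∃ ω : HeatKernel.LInfty →ₗ[ℝ] ℝ, HeatKernel.IsGeneralisedLimit ω ∧
        HeatKernel.IsDilationInvariant ω ∧ HeatKernel.RespectsAE ω ∧
        ∀ A ∈ HeatKernel.dixmierIdeal N τ, HeatKernel.xi τ q γ A = HeatKernel.xi τ q ω A := by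
  have general := mainTheorem7_general N τ hτ.isNormalTrace q hq
  exact ⟨general.1, fun γ hγ hlin => general.2 γ hγ fun c _ => hlin.map_smul c⟩
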